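/- All vector spaces with connection below are over fields of formal Laurent series with complex coefficients; $\partial_t$ denotes the action of $\nabla_{\partial_t}$. For $\rho\in u\mathbb{C}[[u]]\setminus\{0\}$, the pull-back $\rho^+M$ of a $\mathbb{C}((t))$-vector space $M$ with connection is $\mathbb{C}((u))\otimes_{\mathbb{C}((t))}M$ (where $f(t)$ acts on $\mathbb{C}((u))$ as $f(\rho(u))$) with $\partial_u(e\otimes m)=e'\otimes m+e\rho'(u)\otimes\partial_t m$, and the push-forward $\rho_+N$ of a $\mathbb{C}((u))$-vector space $N$ with connection is $N$ with $f(t)\cdot n=f(\rho(u))n$ and $\partial_t=\rho'(u)^{-1}\partial_u$. For $\varphi\in\mathbb{C}((u))$, $\mathcal{E}^\varphi$ is $\mathbb{C}((u))$ with the connection $d+d\varphi$. A finite dimensional $\mathbb{C}((u))$-vector space with connection is called regular if in some basis the matrix of $u\partial_u$ has entries in $\mathbb{C}[[u]]$; for regular $R$ put $$\mathrm{El}(\rho,\varphi,R)=\rho_+(\mathcal{E}^\varphi\otimes R).$$ **Proposition 3.4.** Let $p_1,p_2\ge 1$ be integers, $\varphi_1\in\mathbb{C}((u))$, $\varphi_2\in\mathbb{C}((v))$,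 and let $R_1$, $R_2$ be finite dimensional vector spaces with regular connection over $\mathbb{C}((u))$ and $\mathbb{C}((v))$ respectively. Set $d=\gcd(p_1,p_2)$, $p_1'=p_1/d$, $p_2'=p_2/d$, $\tilde\rho_1(w)=w^{p_1'}$, $\tilde\rho_2(w)=w^{p_2'}$, $$\varphi^{(k)}(w)=\varphi_1\big(w^{p_2'}\big)+\varphi_2\big((e^{2\pi i k d/p_1p_2}\,w)^{p_1'}\big)\quad(k=0,\dots,d-1),\qquad R=\tilde\rho_2^{\,+}R_1\otimes\tilde\rho_1^{\,+}R_2 .$$ Then $R$ is regular, and there is an isomorphism of $\mathbb{C}((t))$-vector spaces with connection $$\mathrm{El}\big([u\mapsto u^{p_1}],\varphi_1,R_1\big)\otimes\mathrm{El}\big([v\mapsto v^{p_2}],\varphi_2,R_2\big)\;\simeq\;\bigoplus_{k=0}^{d-1}\mathrm{El}\big([w\mapsto w^{p_1p_2/d}],\varphi^{(k)},R\big).$$ -/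

import Mathlib

universe u v

namespace FormalConn

open scoped TensorProduct

/-- The field `ℂ((t))` of formal Laurent series. The name of the variable (`t`, `u`, `v`, `w`, …)
is immaterial: all these fields are the same Lean type. -/
abbrev Laurent : Type := LaurentSeries ℂ

/-! ### The derivation `d/dt` of `ℂ((t))` -/

theorem coeff_derivative (f : Laurent) (n : ℤ) :
    (LaurentSeries.derivative ℂ f).coeff n = ((n + 1 : ℤ) : ℂ) * f.coeff (n + 1) := by
  simp [LaurentSeries.derivative_apply]

/-- The Euler operator `f ↦ t f'` as a series, used for the Leibniz rule. -/
noncomputable def euler (f : Laurent) : Laurent :=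
  HahnSeries.single 1 1 * LaurentSeries.derivative ℂ f

theorem coeff_euler (f : Laurent) (n : ℤ) : (euler f).coeff n = (n : ℂ) * f.coeff n := by
  have h := HahnSeries.coeff_single_mul_add (r := (1 : ℂ))
    (x := LaurentSeries.derivative ℂ f) (a := n - 1) (b := 1)
  rw [sub_add_cancel, coeff_derivative, sub_add_cancel, one_mul] at h
  exact h

theorem support_euler (f : Laurent) : (euler f).support ⊆ f.support := by
  intro n hn h
  exact hn (by simp [coeff_euler, h])

theorem euler_mul (f g : Laurent) : euler (f * g) = f * euler g + g * euler f := by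
  ext n
  rw [mul_comm g, coeff_euler, HahnSeries.coeff_add,
    HahnSeries.coeff_mul_right' g.isPWO_support (support_euler g),
    HahnSeries.coeff_mul_left' f.isPWO_support (support_euler f), HahnSeries.coeff_mul,
    Finset.mul_sum, ← Finset.sum_add_distrib]
  refine Finset.sum_congr rfl fun ij hij => ?_
  rw [Finset.mem_antidiagonal] at hij
  rw [coeff_euler, coeff_euler, ← hij.2.2]
  push_cast
  ring

theorem derivative_mul (f g : Laurent) :
    LaurentSeries.derivative ℂ (f * g) =
      f * LaurentSeries.derivative ℂ g + g * LaurentSeries.derivative ℂ f := by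
  have h := euler_mul f g
  have hX : (HahnSeries.single (1 : ℤ) (1 : ℂ) : Laurent) ≠ 0 := by simp
  refine mul_left_cancel₀ hX ?_
  unfold euler at h
  rw [h]
  ring

/-- A differential ring from an additive map with the Leibniz rule. -/
@[reducible]
def differentialOfLeibniz {A : Type} [CommRing A] (D : A →+ A)
    (h : ∀ f g, D (f * g) = f * D g + g * D f) : Differential A where
  deriv := Derivation.mk' D.toIntLinearMap (fun f g => by simpa using h f g)

/-- `ℂ((t))` is a differential field, with Mathlib's termwise derivative `d/dt`. -/
noncomputable instance : Differential Laurent :=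
  differentialOfLeibniz (LaurentSeries.derivative ℂ).toAddMonoidHom derivative_mul

open scoped Differential

theorem deriv_add {A : Type} [CommRing A] [Differential A] (f g : A) : (f + g)′ = f′ + g′ :=
  map_add _ f g

theorem deriv_mul {A : Type} [CommRing A] [Differential A] (f g : A) :
    (f * g)′ = f * g′ + g * f′ :=
  Derivation.leibniz _ f g

theorem deriv_def (f : Laurent) : f′ = LaurentSeries.derivative ℂ f := rfl

theorem deriv_coe (f : PowerSeries ℂ) :
    (f : Laurent)′ = ((PowerSeries.derivative ℂ f : PowerSeries ℂ) : Laurent) := by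
  ext n
  rw [deriv_def, coeff_derivative, PowerSeries.coeff_coe, PowerSeries.coeff_coe]
  rcases lt_trichotomy n (-1) with h | h | h
  · rw [if_pos (by omega), if_pos (by omega), mul_zero]
  · subst h; simp
  · lift n to ℕ using (by omega)
    rw [if_neg (by omega), if_neg (by omega), PowerSeries.coeff_derivative]
    simp [mul_comm, show ((n : ℤ) + 1).natAbs = n + 1 by omega]

/-! ### Vector spaces with connection over a differential field -/

/-- A homomorphism `σ : F → E` of differential fields up to a nonzero factor `jac`, that is, a
homomorphism with the chain rule `(σ f)' = jac · σ(f')`. For `F = ℂ((t))`, `E = ℂ((u))` and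
`σ f = f ∘ ρ`, the factor is `jac = ρ'(u)`. -/
structure ChainHom (F E : Type) [Field F] [Differential F] [Field E] [Differential E] where
  hom : F →+* E
  jac : E
  jac_ne : jac ≠ 0
  chain : ∀ f : F, (hom f)′ = jac * hom (f′)

/-- An `F`-vector space with connection; `del` is the action of the derivation of `F`
(`∇_{∂_t}` when `F = ℂ((t))`). -/
structure ConnModule (F : Type) [Field F] [Differential F] where
  carrier : Type u
  [addCommGroup : AddCommGroup carrier]
  [module : Module F carrier]
  del : carrier →+ carrier
  leibniz : ∀ (f : F) (m : carrier), del (f • m) = f′ • m + f • del m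

attribute [instance] ConnModule.addCommGroup ConnModule.module

namespace ConnModule

section Generic

variable {F E : Type} [Field F] [Differential F] [Field E] [Differential E]

/-- Isomorphism of vector spaces with connection. -/
def Isomorphic (M : ConnModule.{u} F) (N : ConnModule.{v} F) : Prop :=
  ∃ e : M.carrier ≃ₗ[F] N.carrier, ∀ m, e (M.del m) = N.del (e m)

/-- The action of the derivation on a tensor product: `∂(m ⊗ n) = ∂m ⊗ n + m ⊗ ∂n`. -/
noncomputable def tensorDel (M : ConnModule.{u} F) (N : ConnModule.{v} F) :
    M.carrier ⊗[F] N.carrier →+ M.carrier ⊗[F] N.carrier :=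
  TensorProduct.liftAddHom
    (AddMonoidHom.mk' (fun m => AddMonoidHom.mk' (fun n => M.del m ⊗ₜ[F] n + m ⊗ₜ[F] N.del n)
        (fun n n' => by simp only [map_add, TensorProduct.tmul_add]; abel))
      (fun m m' => by
        ext n
        simp only [map_add, TensorProduct.add_tmul, AddMonoidHom.mk'_apply, AddMonoidHom.add_apply]
        abel))
    (fun f m n => by
      simp only [AddMonoidHom.mk'_apply, M.leibniz, N.leibniz, TensorProduct.add_tmul,
        TensorProduct.tmul_add, TensorProduct.smul_tmul]
      abel)

theorem tensorDel_tmul (M : ConnModule.{u} F) (N : ConnModule.{v} F) (m : M.carrier)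
    (n : N.carrier) : tensorDel M N (m ⊗ₜ n) = M.del m ⊗ₜ n + m ⊗ₜ N.del n := rfl

theorem tensorDel_leibniz (M : ConnModule.{u} F) (N : ConnModule.{v} F) (f : F)
    (x : M.carrier ⊗[F] N.carrier) :
    tensorDel M N (f • x) = f′ • x + f • tensorDel M N x := by
  induction x using TensorProduct.induction_on with
  | zero => simp
  | tmul m n =>
    rw [TensorProduct.smul_tmul', tensorDel_tmul, tensorDel_tmul, M.leibniz,
      TensorProduct.add_tmul, smul_add, TensorProduct.smul_tmul', TensorProduct.smul_tmul',
      TensorProduct.smul_tmul', add_assoc]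
  | add x y hx hy =>
    rw [smul_add, map_add, hx, hy, map_add, smul_add, smul_add]
    abel

/-- The tensor product, with `∂(m ⊗ n) = ∂m ⊗ n + m ⊗ ∂n`. -/
noncomputable def tensor (M : ConnModule.{u} F) (N : ConnModule.{v} F) :
    ConnModule.{max u v} F where
  carrier := M.carrier ⊗[F] N.carrier
  del := tensorDel M N
  leibniz := tensorDel_leibniz M N

/-- The direct sum of a finite family, with `∂` acting componentwise. -/
def directSum {ι : Type} [Finite ι] (M : ι → ConnModule.{u} F) : ConnModule.{u} F where
  carrier := ∀ i, (M i).carrier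
  del := AddMonoidHom.mk' (fun m i => (M i).del (m i)) (fun m m' => by ext i; simp)
  leibniz f m := by ext i; simp [(M i).leibniz]

/-- The rank one space `𝓔^φ`: the field itself with `∇ = d + dφ`, so that `∂ 1 = φ'`. -/
def expo (φ : F) : ConnModule.{0} F where
  carrier := F
  del := AddMonoidHom.mk' (fun f => f′ + φ′ * f) (fun f g => by rw [deriv_add]; ring)
  leibniz f g := by
    simp only [AddMonoidHom.mk'_apply, smul_eq_mul, deriv_mul]
    ring

section Pullback

variable [Algebra F E]

/-- The action of the derivation on `E ⊗_F M`, where `(a · 1)' = s · (a' · 1)` for `a` in `F`: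
`∂(e ⊗ m) = e' ⊗ m + e s ⊗ ∂m`. -/
noncomputable def pullbackDel (s : E) (hs : ∀ a : F, (algebraMap F E a)′ = s * algebraMap F E (a′))
    (M : ConnModule.{u} F) : E ⊗[F] M.carrier →+ E ⊗[F] M.carrier :=
  TensorProduct.liftAddHom
    (AddMonoidHom.mk' (fun e => AddMonoidHom.mk'
        (fun m => (e′) ⊗ₜ[F] m + (e * s) ⊗ₜ[F] M.del m)
        (fun m m' => by simp only [map_add, TensorProduct.tmul_add]; abel))
      (fun e e' => by
        ext m
        simp only [deriv_add, TensorProduct.add_tmul, AddMonoidHom.mk'_apply,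
          AddMonoidHom.add_apply, add_mul]
        abel))
    (fun f e m => by
      have h1 : (f • e)′ = f • (e′) + (f′) • (e * s) := by
        simp only [Algebra.smul_def, deriv_mul, hs]
        ring
      simp only [AddMonoidHom.mk'_apply, M.leibniz, h1, TensorProduct.add_tmul,
        TensorProduct.tmul_add, TensorProduct.smul_tmul, smul_mul_assoc]
      abel)

theorem pullbackDel_tmul (s : E) (hs : ∀ a : F, (algebraMap F E a)′ = s * algebraMap F E (a′))
    (M : ConnModule.{u} F) (e : E) (m : M.carrier) :
    pullbackDel s hs M (e ⊗ₜ m) = (e′) ⊗ₜ m + (e * s) ⊗ₜ M.del m := rfl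

theorem pullbackDel_leibniz (s : E)
    (hs : ∀ a : F, (algebraMap F E a)′ = s * algebraMap F E (a′))
    (M : ConnModule.{u} F) (f : E) (x : E ⊗[F] M.carrier) :
    pullbackDel s hs M (f • x) = (f′) • x + f • pullbackDel s hs M x := by
  induction x using TensorProduct.induction_on with
  | zero => simp
  | tmul e m =>
    rw [TensorProduct.smul_tmul', pullbackDel_tmul, pullbackDel_tmul, smul_add,
      TensorProduct.smul_tmul', TensorProduct.smul_tmul', TensorProduct.smul_tmul',
      smul_eq_mul, smul_eq_mul, smul_eq_mul, smul_eq_mul, deriv_mul,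
      TensorProduct.add_tmul, mul_assoc, mul_comm e]
    abel
  | add x y hx hy =>
    rw [smul_add, map_add, hx, hy, map_add, smul_add, smul_add]
    abel

end Pullback

/-- The pull-back `σ⁺M = E ⊗_F M` (with `E` an `F`-algebra through `σ`), with
`∂(e ⊗ m) = e' ⊗ m + e · jac ⊗ ∂m`; in particular `∂(1 ⊗ m) = jac ⊗ ∂m`. -/
noncomputable def pullback (σ : ChainHom F E) (M : ConnModule.{u} F) : ConnModule.{u} E :=
  letI : Algebra F E := σ.hom.toAlgebra
  { carrier := E ⊗[F] M.carrier
    del := pullbackDel σ.jac σ.chain M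
    leibniz := pullbackDel_leibniz σ.jac σ.chain M }

/-- The push-forward `σ₊N`: the same additive group, with scalars `f · n = σ(f) n` and with
`jac⁻¹ ∂` as action of the derivation of `F`. -/
noncomputable def pushforward (σ : ChainHom F E) (N : ConnModule.{u} E) : ConnModule.{u} F :=
  letI : Module F N.carrier := Module.compHom N.carrier σ.hom
  { carrier := N.carrier
    del := AddMonoidHom.mk' (fun n => σ.jac⁻¹ • N.del n)
      (fun n n' => by simp only [map_add, smul_add])
    leibniz := fun f n => by
      change σ.jac⁻¹ • N.del (σ.hom f • n) = σ.hom (f′) • n + σ.hom f • (σ.jac⁻¹ • N.del n)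
      rw [N.leibniz, σ.chain, smul_add, smul_smul, smul_smul, smul_smul,
        inv_mul_cancel_left₀ σ.jac_ne, mul_comm σ.jac⁻¹] }

end Generic

/-- `R` is a finite dimensional `ℂ((u))`-vector space whose connection has a regular singularity
(possibly none): in some basis the matrix of `u∂_u` has entries in `ℂ[[u]]`. -/
def IsRegular (R : ConnModule.{u} Laurent) : Prop :=
  ∃ (n : ℕ) (b : Module.Basis (Fin n) Laurent R.carrier) (A : Matrix (Fin n) (Fin n) (PowerSeries ℂ)),
    ∀ j, (HahnSeries.single (1 : ℤ) (1 : ℂ) : Laurent) • R.del (b j) =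
      ∑ i, ((A i j : PowerSeries ℂ) : Laurent) • b i

end ConnModule

/-! ### Formal maps between formal discs -/

/-- A formal map of degree at least one between formal discs, `u ↦ t = ρ(u)`, with
`ρ ∈ uℂ[[u]]` nonzero. -/
structure DiscMap where
  series : PowerSeries ℂ
  constantCoeff_eq : PowerSeries.constantCoeff series = 0
  ne_zero : series ≠ 0

namespace DiscMap

theorem hasSubst (ρ : DiscMap) : PowerSeries.HasSubst ρ.series :=
  PowerSeries.HasSubst.of_constantCoeff_zero' ρ.constantCoeff_eq

/-- `f ↦ f ∘ ρ` on power series, with values in Laurent series. -/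
noncomputable def substHom (ρ : DiscMap) : PowerSeries ℂ →+* Laurent :=
  (HahnSeries.ofPowerSeries ℤ ℂ).comp
    (PowerSeries.substAlgHom (R := ℂ) (S := ℂ) ρ.hasSubst : PowerSeries ℂ →+* PowerSeries ℂ)

theorem substHom_apply (ρ : DiscMap) (f : PowerSeries ℂ) :
    ρ.substHom f = ((f.subst ρ.series : PowerSeries ℂ) : Laurent) := by
  change HahnSeries.ofPowerSeries ℤ ℂ (PowerSeries.substAlgHom ρ.hasSubst f) = _
  rw [PowerSeries.coe_substAlgHom]

theorem substHom_injective (ρ : DiscMap) : Function.Injective ρ.substHom := by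
  rw [injective_iff_map_eq_zero]
  intro f hf
  by_contra hne
  have hX : ρ.substHom PowerSeries.X ≠ 0 := by
    rw [substHom_apply, PowerSeries.subst_X ρ.hasSubst]
    intro h
    exact ρ.ne_zero (HahnSeries.ofPowerSeries_injective (h.trans (map_zero _).symm))
  have hu := (PowerSeries.isUnit_divided_by_X_pow_order hne).map ρ.substHom
  rw [← PowerSeries.X_pow_order_mul_divXPowOrder (f := f), map_mul, map_pow] at hf
  exact mul_ne_zero (pow_ne_zero _ hX) hu.ne_zero hf

/-- Composition `f ↦ f ∘ ρ` with a formal map, as a homomorphism `ℂ((t)) → ℂ((u))`: the unique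
extension to the fraction fields of substitution of power series. -/
noncomputable def comp (ρ : DiscMap) : Laurent →+* Laurent :=
  IsFractionRing.lift (A := PowerSeries ℂ) (K := Laurent) ρ.substHom_injective

theorem comp_coe (ρ : DiscMap) (f : PowerSeries ℂ) :
    ρ.comp (f : Laurent) = ((f.subst ρ.series : PowerSeries ℂ) : Laurent) := by
  rw [← substHom_apply]
  exact IsFractionRing.lift_algebraMap ρ.substHom_injective f

theorem deriv_series_ne (ρ : DiscMap) : (ρ.series : Laurent)′ ≠ 0 := by
  rw [deriv_coe]
  intro h
  have h' : PowerSeries.derivative ℂ ρ.series = 0 :=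
    HahnSeries.ofPowerSeries_injective (h.trans (map_zero _).symm)
  refine ρ.ne_zero (PowerSeries.derivative.ext ?_ ?_)
  · simp [h']
  · simp [ρ.constantCoeff_eq]

theorem chain_coe (ρ : DiscMap) (f : PowerSeries ℂ) :
    (ρ.comp (f : Laurent))′ = (ρ.series : Laurent)′ * ρ.comp ((f : Laurent)′) := by
  rw [comp_coe, deriv_coe, deriv_coe, deriv_coe, comp_coe,
    PowerSeries.derivative_subst ρ.hasSubst, mul_comm, PowerSeries.coe_mul]

theorem chain (ρ : DiscMap) (f : Laurent) :
    (ρ.comp f)′ = (ρ.series : Laurent)′ * ρ.comp (f′) := by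
  obtain ⟨a, b, hb, rfl⟩ := IsFractionRing.div_surjective (A := PowerSeries ℂ) f
  set x : Laurent := algebraMap (PowerSeries ℂ) Laurent a with hx
  set y : Laurent := algebraMap (PowerSeries ℂ) Laurent b with hy
  have hy0 : y ≠ 0 := by
    have := nonZeroDivisors.ne_zero hb
    rw [hy]
    exact fun h => this (HahnSeries.ofPowerSeries_injective (h.trans (map_zero _).symm))
  have ha := ρ.chain_coe a
  have hb' := ρ.chain_coe b
  change (ρ.comp x)′ = _ * ρ.comp (x′) at ha
  change (ρ.comp y)′ = _ * ρ.comp (y′) at hb'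
  have hz : x / y * y = x := div_mul_cancel₀ x hy0
  generalize x / y = z at hz ⊢
  have hcy : ρ.comp y ≠ 0 := by simpa using hy0
  rw [← hz, map_mul, deriv_mul, deriv_mul, map_add, map_mul, map_mul, hb'] at ha
  refine mul_left_cancel₀ hcy ?_
  linear_combination ha

/-- The homomorphism `f ↦ f ∘ ρ` with its chain rule `(f ∘ ρ)' = ρ' · (f' ∘ ρ)`. -/
noncomputable def toChainHom (ρ : DiscMap) : ChainHom Laurent Laurent where
  hom := ρ.comp
  jac := ((ρ.series : Laurent)′)
  jac_ne := ρ.deriv_series_ne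
  chain := ρ.chain

/-- The map `u ↦ u ^ n`, `n ≥ 1`. -/
noncomputable def power (n : ℕ) (hn : 0 < n) : DiscMap where
  series := PowerSeries.X ^ n
  constantCoeff_eq := by simp [hn.ne']
  ne_zero := pow_ne_zero _ PowerSeries.X_ne_zero

/-- The map `μ_ζ : u ↦ ζ u`, `ζ ≠ 0`. -/
noncomputable def scale (ζ : ℂ) (hζ : ζ ≠ 0) : DiscMap where
  series := PowerSeries.C ζ * PowerSeries.X
  constantCoeff_eq := by simp
  ne_zero := mul_ne_zero (by simpa using hζ) PowerSeries.X_ne_zero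

end DiscMap

/-- The pull-back `ρ⁺M` of a vector space with connection by a formal map. -/
noncomputable def pull (ρ : DiscMap) (M : ConnModule.{u} Laurent) : ConnModule.{u} Laurent :=
  M.pullback ρ.toChainHom

/-- The elementary formal connection `El(ρ, φ, R) = ρ₊(𝓔^φ ⊗ R)`, to be used with `R` regular. -/
noncomputable def El (ρ : DiscMap) (φ : Laurent) (R : ConnModule.{u} Laurent) :
    ConnModule.{u} Laurent :=
  ((ConnModule.expo φ).tensor R).pushforward ρ.toChainHom

end FormalConn

namespace FormalConn

open scoped TensorProduct Differential

/-! ### The exponential of a lower triangular operator on `ℂ[[u]]^ι` -/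

section Exponential

/-! Write `K`, `E₁`, `E₂`, `F` for the Laurent series fields in t, u, v, w, and put m = p₁/d, n =
p₂/d. The two ramified covers have a fibre product with d branches: with ζ_k = e^(2πikd/p₁p₂), the
maps u ↦ w^n, v ↦ (ζ_k w)^m agree over `K` and identify `E₁ ⊗_K E₂` with a product of d copies of
`F`. Hence a tensor product over `K` of an `E₁`-space and an `E₂`-space splits into d pieces, the
k-th being the tensor product over `F` of their pull-backs along the k-th branch.

On that branch the exponential factors add up to φ^(k), R₁ becomes its pull-back by w^n, and R₂
becomes its pull-back by w^m followed by the rotation w ↦ ζ_k w. The rotation can be dropped because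
a regular connection is isomorphic to its pull-back by any w ↦ e^c w, through exp(c w∂_w)
(`IsRegular.exists_monodromy`). This exponential makes sense because w∂_w preserves a lattice and
its w-adic filtration, so it can be formed on each finite dimensional quotient; the relation [w∂_w,
w] = w makes it semilinear along the rotation.

The field isomorphism itself is not constructed. Sums of products of images of `E₁` and `E₂` contain
every vector supported on one branch (`single_mem_closure`: Bézout and orthogonality of roots of
unity). This makes the comparison map surjective, and equality of dimensions over `K` makes it
bijective (`tensor_lift_bijective`). Horizontality is checked on pure tensors by the chain rule
(`exists_twisted_pairing`). -/

theorem exp_intertwine {V W : Type*} [NormedAddCommGroup V] [NormedSpace ℂ V] [CompleteSpace V]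
    [NormedAddCommGroup W] [NormedSpace ℂ W] [CompleteSpace W]
    (B : V →L[ℂ] W) (S : V →L[ℂ] V) (T : W →L[ℂ] W) (h : B ∘L S = T ∘L B) (x : V) :
    B (NormedSpace.exp S x) = NormedSpace.exp T (B x) := by
  have hpow : ∀ (n : ℕ) (y : V), B ((S ^ n) y) = (T ^ n) (B y) := by
    intro n
    induction n with
    | zero => intro y; rfl
    | succ n ih =>
      intro y
      rw [pow_succ, pow_succ, mul_apply_eq_comp, mul_apply_eq_comp, ih]
      exact congrArg _ (DFunLike.congr_fun h y)
  have h1 := (NormedSpace.exp_series_hasSum_exp' (𝕂 := ℂ) S).mapL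
    (B ∘L ContinuousLinearMap.apply ℂ V x)
  have h2 := (NormedSpace.exp_series_hasSum_exp' (𝕂 := ℂ) T).mapL
    (ContinuousLinearMap.apply ℂ W (B x))
  refine h1.unique ?_
  have h3 : (fun n : ℕ => (B ∘L ContinuousLinearMap.apply ℂ V x) ((n.factorial : ℂ)⁻¹ • S ^ n)) =
      fun n : ℕ => ContinuousLinearMap.apply ℂ W (B x) ((n.factorial : ℂ)⁻¹ • T ^ n) := by
    funext n
    change B (((n.factorial : ℂ)⁻¹ • S ^ n) x) = ((n.factorial : ℂ)⁻¹ • T ^ n) (B x)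
    rw [smul_apply, smul_apply, map_smul, hpow]
  rw [h3]
  exact h2

theorem exp_add_smul_one {V : Type*} [NormedAddCommGroup V] [NormedSpace ℂ V] [CompleteSpace V]
    (S : V →L[ℂ] V) (c : ℂ) :
    NormedSpace.exp (S + c • (1 : V →L[ℂ] V)) = Complex.exp c • NormedSpace.exp S := by
  let _ : NormedAlgebra ℚ (V →L[ℂ] V) := NormedAlgebra.restrictScalars ℚ ℂ _
  rw [NormedSpace.exp_add_of_commute ((Commute.one_right S).smul_right c),
    ← Algebra.algebraMap_eq_smul_one, ← NormedSpace.algebraMap_exp_comm, ← Complex.exp_eq_exp_ℂ,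
    Algebra.algebraMap_eq_smul_one, mul_smul_comm, mul_one]

theorem exp_neg_apply_exp {V : Type*} [NormedAddCommGroup V] [NormedSpace ℂ V] [CompleteSpace V]
    (S : V →L[ℂ] V) (x : V) : NormedSpace.exp (-S) (NormedSpace.exp S x) = x := by
  let _ : NormedAlgebra ℚ (V →L[ℂ] V) := NormedAlgebra.restrictScalars ℚ ℂ _
  rw [← mul_apply_eq_comp,
    ← NormedSpace.exp_add_of_commute (Commute.neg_left (Commute.refl S)), neg_add_cancel,
    NormedSpace.exp_zero, one_apply_eq_self]

variable {ι : Type}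

/-- The first `N` coefficients of a vector of power series. -/
noncomputable def trunc (ι : Type) (N : ℕ) : (ι → PowerSeries ℂ) →ₗ[ℂ] (Fin N → ι → ℂ) where
  toFun x k i := PowerSeries.coeff k (x i)
  map_add' x y := by ext; simp
  map_smul' a x := by ext; simp

/-- The vector of polynomials with given first `N` coefficients. -/
def extend (ι : Type) (N : ℕ) : (Fin N → ι → ℂ) →ₗ[ℂ] (ι → PowerSeries ℂ) where
  toFun v i := PowerSeries.mk fun k => if h : k < N then v ⟨k, h⟩ i else 0
  map_add' x y := by
    ext i k
    by_cases h : k < N <;> simp [h]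
  map_smul' a x := by
    ext i k
    by_cases h : k < N <;> simp [h]

theorem trunc_extend (N : ℕ) (v : Fin N → ι → ℂ) : trunc ι N (extend ι N v) = v := by
  ext k i
  simp [trunc, extend]

theorem ext_trunc {x y : ι → PowerSeries ℂ} (h : ∀ N, trunc ι N x = trunc ι N y) : x = y := by
  ext i k
  exact congrFun (congrFun (h (k + 1)) ⟨k, k.lt_succ_self⟩) i

theorem trunc_eq_zero_iff {N : ℕ} {x : ι → PowerSeries ℂ} :
    trunc ι N x = 0 ↔ ∃ y : ι → PowerSeries ℂ, x = (PowerSeries.X ^ N : PowerSeries ℂ) • y := by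
  constructor
  · intro h
    have hd : ∀ i, PowerSeries.X ^ N ∣ x i := fun i =>
      PowerSeries.X_pow_dvd_iff.2 fun m hm => congrFun (congrFun h ⟨m, hm⟩) i
    choose y hy using hd
    exact ⟨y, funext hy⟩
  · rintro ⟨y, rfl⟩
    ext k i
    exact PowerSeries.X_pow_dvd_iff.1 (dvd_mul_right _ (y i)) k k.2

/-- The operator preserves the `u`-adic filtration. -/
def Filtered (D : (ι → PowerSeries ℂ) →ₗ[ℂ] (ι → PowerSeries ℂ)) : Prop :=
  ∀ N x, trunc ι N x = 0 → trunc ι N (D x) = 0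

theorem Filtered.neg {D : (ι → PowerSeries ℂ) →ₗ[ℂ] (ι → PowerSeries ℂ)} (hD : Filtered D) :
    Filtered (-D) := fun N x hx => by simp [hD N x hx]

theorem Filtered.smul {D : (ι → PowerSeries ℂ) →ₗ[ℂ] (ι → PowerSeries ℂ)} (hD : Filtered D)
    (c : ℂ) : Filtered (c • D) := fun N x hx => by simp [hD N x hx]

/-- Multiplication by the variable. -/
noncomputable def mulX (ι : Type) : (ι → PowerSeries ℂ) →ₗ[ℂ] (ι → PowerSeries ℂ) where
  toFun x := (PowerSeries.X : PowerSeries ℂ) • x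
  map_add' := smul_add _
  map_smul' _ _ := smul_comm _ _ _

theorem mulX_apply (x : ι → PowerSeries ℂ) : mulX ι x = (PowerSeries.X : PowerSeries ℂ) • x := rfl

theorem filtered_mulX : Filtered (mulX ι) := by
  intro N x hx
  obtain ⟨y, rfl⟩ := trunc_eq_zero_iff.1 hx
  exact trunc_eq_zero_iff.2 ⟨(PowerSeries.X : PowerSeries ℂ) • y, smul_comm _ _ _⟩

/-- An operator with the commutation relation `[D, u] = u` of `u∂_u`. -/
def EulerLike (D : (ι → PowerSeries ℂ) →ₗ[ℂ] (ι → PowerSeries ℂ)) : Prop :=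
  ∀ x, D (mulX ι x) = mulX ι (D x + x)

/-- Moving one factor u past D at a time shows that D sends multiples of u^N to multiples of u^N. -/
theorem EulerLike.filtered {D : (ι → PowerSeries ℂ) →ₗ[ℂ] (ι → PowerSeries ℂ)}
    (hD : EulerLike D) : Filtered D := by
  intro N
  have h : ∀ y, ∃ z, D ((PowerSeries.X ^ N : PowerSeries ℂ) • y) =
      (PowerSeries.X ^ N : PowerSeries ℂ) • z := by
    induction N with
    | zero => exact fun y => ⟨D y, by simp⟩
    | succ N ih =>
      intro y
      obtain ⟨z, hz⟩ := ih y
      refine ⟨z + y, ?_⟩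
      rw [pow_succ', mul_smul, mul_smul, ← mulX_apply, hD, hz, ← smul_add, mulX_apply]
  intro x hx
  obtain ⟨y, rfl⟩ := trunc_eq_zero_iff.1 hx
  obtain ⟨z, hz⟩ := h y
  exact trunc_eq_zero_iff.2 ⟨z, hz⟩

variable [Fintype ι]

/-- The operator induced on the first `N` coefficients. -/
noncomputable def truncOp (D : (ι → PowerSeries ℂ) →ₗ[ℂ] (ι → PowerSeries ℂ)) (N : ℕ) :
    (Fin N → ι → ℂ) →L[ℂ] (Fin N → ι → ℂ) :=
  LinearMap.toContinuousLinearMap (trunc ι N ∘ₗ D ∘ₗ extend ι N)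

/-- A vector and the polynomial lift of its truncation differ by a multiple of u^N, which D does not
bring below order N. So `truncOp` is the operator induced on the quotient, independent of the lift.
-/
theorem trunc_apply_of_filtered {D : (ι → PowerSeries ℂ) →ₗ[ℂ] (ι → PowerSeries ℂ)}
    (hD : Filtered D) (N : ℕ) (x : ι → PowerSeries ℂ) :
    trunc ι N (D x) = truncOp D N (trunc ι N x) := by
  have h := hD N (x - extend ι N (trunc ι N x)) (by rw [map_sub, trunc_extend, sub_self])
  rw [map_sub, map_sub, sub_eq_zero] at h
  exact h

/-- Restriction to fewer coefficients. -/
noncomputable def restrict (ι : Type) [Fintype ι] {K N : ℕ} (h : K ≤ N) :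
    (Fin N → ι → ℂ) →L[ℂ] (Fin K → ι → ℂ) :=
  LinearMap.toContinuousLinearMap (LinearMap.funLeft ℂ (ι → ℂ) (Fin.castLE h))

theorem restrict_trunc {K N : ℕ} (h : K ≤ N) (x : ι → PowerSeries ℂ) :
    restrict ι h (trunc ι N x) = trunc ι K x := rfl

/-- The exponential `e^D` of an operator preserving the `u`-adic filtration. -/
noncomputable def expOp (D : (ι → PowerSeries ℂ) →ₗ[ℂ] (ι → PowerSeries ℂ))
    (x : ι → PowerSeries ℂ) : ι → PowerSeries ℂ := fun i =>
  PowerSeries.mk fun k =>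
    -- Level `k + 1` is the smallest truncation that contains coefficient `k`; by `trunc_expOp` any
    -- higher level gives the same value.
    NormedSpace.exp (truncOp D (k + 1)) (trunc ι (k + 1) x) ⟨k, k.lt_succ_self⟩ i

/-- Restriction between truncation levels intertwines the induced operators, hence their
exponentials. -/
theorem trunc_expOp {D : (ι → PowerSeries ℂ) →ₗ[ℂ] (ι → PowerSeries ℂ)} (hD : Filtered D)
    (N : ℕ) (x : ι → PowerSeries ℂ) :
    trunc ι N (expOp D x) = NormedSpace.exp (truncOp D N) (trunc ι N x) := by
  ext k i
  have hk : (k : ℕ) + 1 ≤ N := k.2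
  have h := exp_intertwine (restrict ι hk) (truncOp D N) (truncOp D (k + 1)) (by
    ext1 v
    rw [ContinuousLinearMap.comp_apply, ContinuousLinearMap.comp_apply]
    conv_lhs => rw [← trunc_extend N v]
    conv_rhs => rw [← trunc_extend N v]
    rw [← trunc_apply_of_filtered hD, restrict_trunc, restrict_trunc,
      trunc_apply_of_filtered hD]) (trunc ι N x)
  rw [restrict_trunc] at h
  simp only [trunc, expOp, LinearMap.coe_mk, AddHom.coe_mk, PowerSeries.coeff_mk]
  exact (congrFun (congrFun h ⟨k, Nat.lt_succ_self _⟩) i).symm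

theorem expOp_intertwine {D D' B : (ι → PowerSeries ℂ) →ₗ[ℂ] (ι → PowerSeries ℂ)}
    (hD : Filtered D) (hD' : Filtered D') (hB : Filtered B) (h : ∀ x, B (D x) = D' (B x))
    (x : ι → PowerSeries ℂ) : B (expOp D x) = expOp D' (B x) := by
  refine ext_trunc fun N => ?_
  rw [trunc_apply_of_filtered hB, trunc_expOp hD, trunc_expOp hD', trunc_apply_of_filtered hB]
  refine exp_intertwine _ _ _ ?_ _
  ext1 v
  rw [ContinuousLinearMap.comp_apply, ContinuousLinearMap.comp_apply]
  conv_lhs => rw [← trunc_extend N v]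
  conv_rhs => rw [← trunc_extend N v]
  rw [← trunc_apply_of_filtered hD, ← trunc_apply_of_filtered hB, h,
    trunc_apply_of_filtered hD', trunc_apply_of_filtered hB]

theorem expOp_add {D : (ι → PowerSeries ℂ) →ₗ[ℂ] (ι → PowerSeries ℂ)} (hD : Filtered D)
    (x y : ι → PowerSeries ℂ) : expOp D (x + y) = expOp D x + expOp D y := by
  refine ext_trunc fun N => ?_
  rw [map_add, trunc_expOp hD, trunc_expOp hD, trunc_expOp hD, map_add, map_add]

theorem expOp_smul {D : (ι → PowerSeries ℂ) →ₗ[ℂ] (ι → PowerSeries ℂ)} (hD : Filtered D)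
    (a : ℂ) (x : ι → PowerSeries ℂ) : expOp D (a • x) = a • expOp D x := by
  refine ext_trunc fun N => ?_
  rw [map_smul, trunc_expOp hD, trunc_expOp hD, map_smul, map_smul]

theorem truncOp_add (D D' : (ι → PowerSeries ℂ) →ₗ[ℂ] (ι → PowerSeries ℂ)) (N : ℕ) :
    truncOp (D + D') N = truncOp D N + truncOp D' N := by
  ext1 v
  simp [truncOp]

theorem truncOp_smul_one (c : ℂ) (N : ℕ) :
    truncOp (c • (1 : (ι → PowerSeries ℂ) →ₗ[ℂ] (ι → PowerSeries ℂ))) N = c • 1 := by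
  ext1 v
  simp [truncOp, trunc_extend]

theorem truncOp_neg (D : (ι → PowerSeries ℂ) →ₗ[ℂ] (ι → PowerSeries ℂ)) (N : ℕ) :
    truncOp (-D) N = -truncOp D N := by
  ext1 v
  simp [truncOp]

theorem expOp_add_smul_one {D : (ι → PowerSeries ℂ) →ₗ[ℂ] (ι → PowerSeries ℂ)} (hD : Filtered D)
    (c : ℂ) (x : ι → PowerSeries ℂ) :
    expOp (D + c • 1) x = Complex.exp c • expOp D x := by
  have hD' : Filtered (D + c • 1) := fun N x hx => by simp [hD N x hx, hx]
  refine ext_trunc fun N => ?_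
  rw [trunc_expOp hD', map_smul, trunc_expOp hD, truncOp_add, truncOp_smul_one,
    exp_add_smul_one, smul_apply]

theorem expOp_neg_expOp {D : (ι → PowerSeries ℂ) →ₗ[ℂ] (ι → PowerSeries ℂ)} (hD : Filtered D)
    (x : ι → PowerSeries ℂ) : expOp (-D) (expOp D x) = x := by
  refine ext_trunc fun N => ?_
  rw [trunc_expOp hD.neg, trunc_expOp hD, truncOp_neg, exp_neg_apply_exp]

theorem expOp_expOp_neg {D : (ι → PowerSeries ℂ) →ₗ[ℂ] (ι → PowerSeries ℂ)} (hD : Filtered D)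
    (c : ℂ) (x : ι → PowerSeries ℂ) : expOp (c • D) (expOp ((-c) • D) x) = x := by
  have h : c • D = -((-c) • D) := LinearMap.ext fun y => by
    rw [LinearMap.neg_apply, LinearMap.smul_apply, LinearMap.smul_apply, neg_smul, neg_neg]
  rw [h]
  exact expOp_neg_expOp (hD.smul (-c)) x

/-- Since Du = u(D + 1), conjugation gives exp(cD)u = u exp(cD + c), and the scalar c exponentiates
separately. -/
theorem expOp_mulX {D : (ι → PowerSeries ℂ) →ₗ[ℂ] (ι → PowerSeries ℂ)} (hD : EulerLike D)
    (c : ℂ) (x : ι → PowerSeries ℂ) :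
    expOp (c • D) (mulX ι x) = Complex.exp c • mulX ι (expOp (c • D) x) := by
  have hF := hD.filtered.smul c
  have hF' : Filtered (c • D + c • 1) := fun N x hx => by simp [hD.filtered N x hx, hx]
  rw [← expOp_intertwine hF' hF filtered_mulX, expOp_add_smul_one hF, map_smul]
  intro x
  rw [LinearMap.smul_apply, hD]
  simp

/-- Constants and the variable are already handled, so peeling off the constant term, f = a + Xg,
shows by induction that the two sides agree modulo X^N for every N. This replaces a continuity
argument in f. -/
theorem expOp_power_series_smul {D : (ι → PowerSeries ℂ) →ₗ[ℂ] (ι → PowerSeries ℂ)}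
    (hD : EulerLike D) (c : ℂ) (f : PowerSeries ℂ) (x : ι → PowerSeries ℂ) :
    expOp (c • D) (f • x) =
      PowerSeries.rescale (Complex.exp c) f • expOp (c • D) x := by
  have hF := hD.filtered.smul c
  have key : ∀ N (f : PowerSeries ℂ), ∃ y : ι → PowerSeries ℂ, expOp (c • D) (f • x) -
      PowerSeries.rescale (Complex.exp c) f • expOp (c • D) x =
        (PowerSeries.X ^ N : PowerSeries ℂ) • y := by
    intro N
    induction N with
    | zero => exact fun f => ⟨_, by rw [pow_zero, one_smul]⟩
    | succ N ih =>
      intro f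
      rw [PowerSeries.eq_X_mul_shift_add_const f]
      set g : PowerSeries ℂ := PowerSeries.mk fun p => PowerSeries.coeff (p + 1) f
      set a := PowerSeries.constantCoeff f
      obtain ⟨y, hy⟩ := ih g
      refine ⟨Complex.exp c • y, ?_⟩
      have hC : ∀ z : ι → PowerSeries ℂ, (PowerSeries.C a : PowerSeries ℂ) • z = a • z := by
        intro z
        ext i k
        simp
      have hC' : PowerSeries.rescale (Complex.exp c) (PowerSeries.C a) = PowerSeries.C a := by
        ext k
        rw [PowerSeries.coeff_rescale, PowerSeries.coeff_C]
        split_ifs with hk <;> simp [hk]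
      have hX : PowerSeries.rescale (Complex.exp c) PowerSeries.X =
          Complex.exp c • (PowerSeries.X : PowerSeries ℂ) := by
        rw [PowerSeries.rescale_X, PowerSeries.smul_eq_C_mul]
      rw [add_smul, expOp_add hF, hC, expOp_smul hF, mul_smul, ← mulX_apply, expOp_mulX hD,
        map_add, map_mul, hC', add_smul, hC, hX, smul_mul_assoc, smul_assoc, mul_smul,
        ← mulX_apply, add_sub_add_right_eq_sub, ← smul_sub, ← map_sub, hy, pow_succ', mul_smul,
        mulX_apply, smul_comm _ (Complex.exp c) y, smul_comm _ (Complex.exp c)]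
  refine ext_trunc fun N => ?_
  rw [← sub_eq_zero, ← map_sub]
  exact trunc_eq_zero_iff.2 (key N f)

theorem expOp_comm {D : (ι → PowerSeries ℂ) →ₗ[ℂ] (ι → PowerSeries ℂ)} (hD : EulerLike D)
    (c : ℂ) (x : ι → PowerSeries ℂ) : D (expOp (c • D) x) = expOp (c • D) (D x) :=
  expOp_intertwine (hD.filtered.smul c) (hD.filtered.smul c) hD.filtered (fun x => by simp) x

end Exponential

/-! ### Composition with formal maps -/

/-- The coordinate of a formal disc. -/
noncomputable def coord : Laurent := ((PowerSeries.X : PowerSeries ℂ) : Laurent)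

theorem coord_eq : coord = (HahnSeries.single (1 : ℤ) (1 : ℂ) : Laurent) :=
  HahnSeries.ofPowerSeries_X

theorem coord_ne_zero : coord ≠ 0 := by
  rw [coord_eq]
  simp

theorem coord_zpow (n : ℤ) : coord ^ n = (HahnSeries.single n (1 : ℂ) : Laurent) := by
  rw [coord_eq]
  induction n with
  | zero => simp
  | succ n ih =>
    rw [zpow_add_one₀ (by simp), ih, HahnSeries.single_mul_single, one_mul]
  | pred n ih =>
    rw [zpow_sub_one₀ (by simp), ih, HahnSeries.inv_single, HahnSeries.single_mul_single, inv_one,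
      one_mul, sub_eq_add_neg]

theorem coord_mul_deriv (f : Laurent) : coord * f′ = euler f := by
  rw [coord_eq]
  rfl

/-- Every Laurent series is a power of the coordinate times a power series. -/
theorem exists_zpow_mul_coe (f : Laurent) :
    ∃ (n : ℤ) (g : PowerSeries ℂ), f = coord ^ n * (g : Laurent) :=
  ⟨f.order, f.powerSeriesPart, by
    rw [coord_zpow]
    exact (LaurentSeries.single_order_mul_powerSeriesPart f).symm⟩

theorem ringHom_ext_of_coe {E : Type} [Field E] {σ τ : Laurent →+* E}
    (h : ∀ f : PowerSeries ℂ, σ (f : Laurent) = τ (f : Laurent)) : σ = τ := by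
  ext f
  obtain ⟨n, g, rfl⟩ := exists_zpow_mul_coe f
  rw [map_mul, map_mul, map_zpow₀, map_zpow₀, coord, h, h]

namespace DiscMap

theorem comp_coord (ρ : DiscMap) : ρ.comp coord = (ρ.series : Laurent) := by
  rw [coord, comp_coe, PowerSeries.subst_X ρ.hasSubst]

theorem comp_comp (ρ σ τ : DiscMap) (h : σ.series.subst ρ.series = τ.series) (f : Laurent) :
    ρ.comp (σ.comp f) = τ.comp f := by
  have : ρ.comp.comp σ.comp = τ.comp := ringHom_ext_of_coe fun g => by
    rw [RingHom.comp_apply, comp_coe, comp_coe, comp_coe,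
      PowerSeries.subst_comp_subst_apply σ.hasSubst ρ.hasSubst, h]
  exact DFunLike.congr_fun this f

theorem comp_scale_coe (ζ : ℂ) (hζ : ζ ≠ 0) (f : PowerSeries ℂ) :
    (scale ζ hζ).comp (f : Laurent) = ((PowerSeries.rescale ζ f : PowerSeries ℂ) : Laurent) := by
  rw [comp_coe, PowerSeries.rescale_eq_subst, PowerSeries.smul_eq_C_mul]
  rfl

theorem comp_scale_coord (ζ : ℂ) (hζ : ζ ≠ 0) :
    (scale ζ hζ).comp coord = HahnSeries.C ζ * coord := by
  rw [comp_coord]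
  simp [scale, coord]

theorem comp_power_coord (n : ℕ) (hn : 0 < n) : (power n hn).comp coord = coord ^ n := by
  rw [comp_coord]
  simp [power, coord]

theorem comp_C (ρ : DiscMap) (a : ℂ) : ρ.comp (HahnSeries.C a) = HahnSeries.C a := by
  rw [← HahnSeries.ofPowerSeries_C, comp_coe, PowerSeries.subst_C]
  rfl

theorem jac_scale (ζ : ℂ) (hζ : ζ ≠ 0) : (scale ζ hζ).toChainHom.jac = HahnSeries.C ζ := by
  change ((scale ζ hζ).series : Laurent)′ = _
  rw [deriv_coe, ← HahnSeries.ofPowerSeries_C]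
  congr 1
  simp [scale]

theorem jac_power (n : ℕ) (hn : 0 < n) :
    (power n hn).toChainHom.jac = (n : Laurent) * coord ^ (n - 1) := by
  change ((power n hn).series : Laurent)′ = _
  rw [deriv_coe]
  simp [power, coord]

theorem comp_power_power (m n q : ℕ) (hm : 0 < m) (hn : 0 < n) (hq : 0 < q) (h : m * n = q)
    (f : Laurent) : (power m hm).comp ((power n hn).comp f) = (power q hq).comp f := by
  subst h
  refine comp_comp _ _ _ ?_ f
  change (PowerSeries.X ^ n : PowerSeries ℂ).subst (PowerSeries.X ^ m : PowerSeries ℂ) =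
    PowerSeries.X ^ (m * n)
  have hs := (power m hm).hasSubst
  change PowerSeries.HasSubst (PowerSeries.X ^ m : PowerSeries ℂ) at hs
  rw [PowerSeries.subst_pow hs, PowerSeries.subst_X hs, pow_mul]

/-- Rotation by a q-th root of unity is a deck transformation of w ↦ w^q. -/
theorem comp_scale_power (ζ : ℂ) (hζ : ζ ≠ 0) (q : ℕ) (hq : 0 < q) (h : ζ ^ q = 1) (f : Laurent) :
    (scale ζ hζ).comp ((power q hq).comp f) = (power q hq).comp f := by
  refine comp_comp _ _ _ ?_ f
  change (PowerSeries.X ^ q : PowerSeries ℂ).subst (PowerSeries.C ζ * PowerSeries.X) =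
    PowerSeries.X ^ q
  have hs := (scale ζ hζ).hasSubst
  change PowerSeries.HasSubst (PowerSeries.C ζ * PowerSeries.X : PowerSeries ℂ) at hs
  rw [PowerSeries.subst_pow hs, PowerSeries.subst_X hs, mul_pow, ← map_pow, h, map_one, one_mul]

end DiscMap

/-! ### The operator u∂_u on a lattice and the rotation of a regular connection -/

namespace ConnModule

variable {ι : Type} [Fintype ι]

/-- The operator `u∂_u` on the lattice with a given matrix. -/
noncomputable def latticeOp (A : Matrix ι ι (PowerSeries ℂ)) :
    (ι → PowerSeries ℂ) →ₗ[ℂ] (ι → PowerSeries ℂ) where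
  toFun x := fun i => PowerSeries.X * PowerSeries.derivative ℂ (x i) + A.mulVec x i
  map_add' x y := by
    ext1 i
    simp only [Pi.add_apply, map_add, Matrix.mulVec_add]
    ring
  map_smul' a x := by
    ext1 i
    rw [Pi.smul_apply, Pi.smul_apply, Derivation.map_smul, Matrix.mulVec_smul, RingHom.id_apply,
      smul_add, mul_smul_comm, Pi.smul_apply]

theorem latticeOp_apply (A : Matrix ι ι (PowerSeries ℂ)) (x : ι → PowerSeries ℂ) (i : ι) :
    latticeOp A x i = PowerSeries.X * PowerSeries.derivative ℂ (x i) + A.mulVec x i := rfl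

theorem eulerLike_latticeOp (A : Matrix ι ι (PowerSeries ℂ)) : EulerLike (latticeOp A) := by
  intro x
  ext1 i
  rw [mulX_apply, mulX_apply, latticeOp_apply, Matrix.mulVec_smul]
  simp only [Pi.smul_apply, Pi.add_apply, latticeOp_apply, smul_eq_mul, Derivation.leibniz,
    PowerSeries.derivative_X]
  ring

variable {P : ConnModule.{u} Laurent}

/-- The inclusion of the lattice spanned by a basis. -/
noncomputable def latticeMap (b : Module.Basis ι Laurent P.carrier) :
    (ι → PowerSeries ℂ) →+ P.carrier where
  toFun x := ∑ i, ((x i : PowerSeries ℂ) : Laurent) • b i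
  map_zero' := by simp
  map_add' x y := by simp [add_smul, Finset.sum_add_distrib]

theorem latticeMap_apply (b : Module.Basis ι Laurent P.carrier) (x : ι → PowerSeries ℂ) :
    latticeMap b x = ∑ i, ((x i : PowerSeries ℂ) : Laurent) • b i := rfl

theorem latticeMap_smul (b : Module.Basis ι Laurent P.carrier) (f : PowerSeries ℂ)
    (x : ι → PowerSeries ℂ) : latticeMap b (f • x) = (f : Laurent) • latticeMap b x := by
  simp [latticeMap_apply, Finset.smul_sum, mul_smul]

theorem latticeMap_single [DecidableEq ι] (b : Module.Basis ι Laurent P.carrier) (i : ι) :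
    latticeMap b (Pi.single i 1) = b i := by
  rw [latticeMap_apply, Finset.sum_eq_single i]
  · simp
  · intro j _ hj
    simp [hj]
  · simp

theorem coord_smul_del_smul (f : Laurent) (m : P.carrier) :
    coord • P.del (f • m) = euler f • m + f • (coord • P.del m) := by
  rw [P.leibniz, smul_add, smul_smul, coord_mul_deriv, smul_comm coord f]

theorem euler_coe (f : PowerSeries ℂ) :
    euler (f : Laurent) = ((PowerSeries.X * PowerSeries.derivative ℂ f : PowerSeries ℂ) : Laurent) := by
  rw [← coord_mul_deriv, deriv_coe, PowerSeries.coe_mul]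
  rfl

theorem coord_smul_del_latticeMap (b : Module.Basis ι Laurent P.carrier)
    (A : Matrix ι ι (PowerSeries ℂ))
    (hA : ∀ j, coord • P.del (b j) = ∑ i, ((A i j : PowerSeries ℂ) : Laurent) • b i)
    (x : ι → PowerSeries ℂ) :
    coord • P.del (latticeMap b x) = latticeMap b (latticeOp A x) := by
  rw [latticeMap_apply, map_sum, Finset.smul_sum]
  simp only [coord_smul_del_smul, hA]
  rw [Finset.sum_add_distrib, latticeMap_apply]
  simp only [latticeOp_apply, PowerSeries.coe_add, add_smul, Finset.sum_add_distrib, euler_coe]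
  congr 1
  simp only [Finset.smul_sum, Matrix.mulVec, dotProduct, smul_smul]
  rw [Finset.sum_comm]
  refine Finset.sum_congr rfl fun i _ => ?_
  rw [← Finset.sum_smul]
  congr 1
  change _ = HahnSeries.ofPowerSeries ℤ ℂ _
  rw [map_sum]
  refine Finset.sum_congr rfl fun j _ => ?_
  rw [map_mul, mul_comm]

/-- A regular connection is isomorphic to its pull-back by `u ↦ e^c u`: the isomorphism is given
by the operator `exp(c u∂_u)`. -/
theorem IsRegular.exists_monodromy (hP : P.IsRegular) (c : ℂ) :
    ∃ T : P.carrier →+ P.carrier,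
      (∀ f m, T (f • m) = (DiscMap.scale (Complex.exp c) (Complex.exp_ne_zero c)).comp f • T m) ∧
      (∀ m, P.del (T m) = (HahnSeries.C (Complex.exp c) : Laurent) • T (P.del m)) ∧
      Submodule.span Laurent (Set.range T) = ⊤ := by
  obtain ⟨n, b, A, hA⟩ := hP
  rw [← coord_eq] at hA
  set σ := DiscMap.scale (Complex.exp c) (Complex.exp_ne_zero c) with hσ
  have hE := eulerLike_latticeOp A
  have hF := hE.filtered.smul c
  -- These are the images of the basis under exp(c u∂_u). The exponential exists only on the
  -- lattice, so `T` is defined as the semilinear extension of its values there.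
  let e : Fin n → P.carrier := fun j => latticeMap b (expOp (c • latticeOp A) (Pi.single j 1))
  let T : P.carrier →+ P.carrier :=
    AddMonoidHom.mk' (fun m => ∑ j, σ.comp (b.repr m j) • e j)
      fun m m' => by simp [add_smul, Finset.sum_add_distrib]
  have hT : ∀ m, T m = ∑ j, σ.comp (b.repr m j) • e j := fun _ => rfl
  have hsmul : ∀ f m, T (f • m) = σ.comp f • T m := by
    intro f m
    simp [hT, Finset.smul_sum, mul_smul]
  have hTb : ∀ j, T (b j) = e j := by
    intro j
    rw [hT, Finset.sum_eq_single j]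
    · simp
    · intro i _ hi
      simp [Finsupp.single_eq_of_ne hi]
    · simp
  -- Both sides are semilinear along the rotation and agree on the basis, so `T` really extends the
  -- exponential.
  have hlat : ∀ x, T (latticeMap b x) = latticeMap b (expOp (c • latticeOp A) x) := by
    intro x
    have hx : x = ∑ j, x j • (Pi.single j 1 : Fin n → PowerSeries ℂ) := by
      ext1 i
      simp [Finset.sum_apply, Pi.single_apply]
    have hadd : ∀ s : Finset (Fin n),
        expOp (c • latticeOp A) (∑ j ∈ s, x j • (Pi.single j 1 : Fin n → PowerSeries ℂ)) =
          ∑ j ∈ s, expOp (c • latticeOp A) (x j • (Pi.single j 1 : Fin n → PowerSeries ℂ)) :=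
      fun s => map_sum (AddMonoidHom.mk' (expOp (c • latticeOp A)) (expOp_add hF)) _ _
    conv_rhs => rw [hx, hadd, map_sum]
    rw [latticeMap_apply, map_sum]
    refine Finset.sum_congr rfl fun j _ => ?_
    rw [hsmul, hTb, expOp_power_series_smul hE, latticeMap_smul, hσ, DiscMap.comp_scale_coe]
  -- The field u d/du is invariant under scaling of u.
  have heul : ∀ f, euler (σ.comp f) = σ.comp (euler f) := by
    intro f
    rw [← coord_mul_deriv, ← coord_mul_deriv, map_mul, DiscMap.comp_scale_coord]
    have h := σ.toChainHom.chain f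
    rw [DiscMap.jac_scale] at h
    change (σ.comp f)′ = _ * σ.comp (f′) at h
    rw [h]
    ring
  have hD : ∀ m, coord • P.del (T m) = T (coord • P.del m) := by
    intro m
    have hb : ∀ j, coord • P.del (T (b j)) = T (coord • P.del (b j)) := by
      intro j
      rw [hTb, coord_smul_del_latticeMap b A hA, expOp_comm hE, ← hlat,
        ← coord_smul_del_latticeMap b A hA, latticeMap_single]
    rw [← b.sum_repr m]
    simp only [map_sum, Finset.smul_sum]
    refine Finset.sum_congr rfl fun j _ => ?_
    rw [hsmul, coord_smul_del_smul, coord_smul_del_smul, hb, map_add,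
      hsmul (euler _), hsmul (b.repr m j) (coord • P.del (b j)), heul]
  refine ⟨T, hsmul, fun m => ?_, ?_⟩
  -- Commutation with u∂_u gives u ∂T = T u∂ = e^c u T∂; cancelling u leaves the factor e^c, the
  -- derivative of the rotation.
  · have h := hD m
    rw [hsmul, DiscMap.comp_scale_coord, mul_comm, mul_smul] at h
    exact smul_right_injective _ coord_ne_zero h
  · rw [eq_top_iff, ← b.span_eq]
    refine Submodule.span_mono ?_
    rintro _ ⟨j, rfl⟩
    -- The inverse exponential supplies a preimage of each basis vector.
    refine ⟨latticeMap b (expOp ((-c) • latticeOp A) (Pi.single j 1)), ?_⟩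
    have h := expOp_expOp_neg hE.filtered c (Pi.single j 1)
    rw [hlat, h, latticeMap_single]

end ConnModule

/-! ### Tensor products over a subfield -/

/-- Separation (`hsep`) lets each component be isolated by acting on pure tensors, and `hspan` then
yields surjectivity. Source and target have the same dimension over `K` by `hfield` and `hrank`, so
surjectivity suffices. -/
theorem tensor_lift_bijective {K E₁ E₂ F : Type} [Field K] [Field E₁] [Field E₂] [Field F]
    [Algebra K E₁] [Algebra K E₂] [Algebra K F]
    [FiniteDimensional K E₁] [FiniteDimensional K E₂] [FiniteDimensional K F]
    {M₁ : Type u} {M₂ : Type v} [AddCommGroup M₁] [AddCommGroup M₂]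
    [Module E₁ M₁] [Module K M₁] [IsScalarTower K E₁ M₁] [FiniteDimensional E₁ M₁]
    [Module E₂ M₂] [Module K M₂] [IsScalarTower K E₂ M₂] [FiniteDimensional E₂ M₂]
    {ι : Type} [Fintype ι] [DecidableEq ι] {N : ι → Type (max u v)} [∀ k, AddCommGroup (N k)]
    [∀ k, Module F (N k)] [∀ k, Module K (N k)] [∀ k, IsScalarTower K F (N k)]
    [∀ k, FiniteDimensional F (N k)]
    (ψ : ∀ k, M₁ →ₗ[K] M₂ →ₗ[K] N k) (τ₁ : ι → E₁ → F) (τ₂ : ι → E₂ → F)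
    (hψ₁ : ∀ k a m n, ψ k (a • m) n = τ₁ k a • ψ k m n)
    (hψ₂ : ∀ k a m n, ψ k m (a • n) = τ₂ k a • ψ k m n)
    (hspan : ∀ k, Submodule.span F (Set.range fun x : M₁ × M₂ => ψ k x.1 x.2) = ⊤)
    (hsep : ∀ k f, (Pi.single k f : ι → F) ∈ AddSubgroup.closure
      (Set.range fun (x : E₁ × E₂) k' => τ₁ k' x.1 * τ₂ k' x.2))
    (hfield : Module.finrank K E₁ * Module.finrank K E₂ = Fintype.card ι * Module.finrank K F)
    (hrank : ∀ k, Module.finrank F (N k) = Module.finrank E₁ M₁ * Module.finrank E₂ M₂) :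
    Function.Bijective (LinearMap.pi fun k => TensorProduct.lift (ψ k)) := by
  set Ψ := LinearMap.pi fun k => TensorProduct.lift (ψ k) with hΨ
  have hΨt : ∀ m n, Ψ (m ⊗ₜ n) = fun k => ψ k m n := fun m n => rfl
  have hpure : ∀ (m : M₁) (n : M₂) (x : ι → F), x ∈ AddSubgroup.closure
      (Set.range fun (x : E₁ × E₂) k' => τ₁ k' x.1 * τ₂ k' x.2) →
      (fun k => x k • ψ k m n) ∈ LinearMap.range Ψ := by
    intro m n x hx
    induction hx using AddSubgroup.closure_induction with
    | mem x hx =>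
      obtain ⟨⟨a, b⟩, rfl⟩ := hx
      refine ⟨(a • m) ⊗ₜ (b • n), ?_⟩
      rw [hΨt]
      funext k
      rw [hψ₁, hψ₂, smul_smul]
    | zero => exact ⟨0, by rw [map_zero]; funext k; simp⟩
    | add x y _ _ hx hy =>
      have := add_mem hx hy
      convert this using 1
      funext k
      simp [add_smul]
    | neg x _ hx =>
      have := neg_mem hx
      convert this using 1
      funext k
      simp
  -- The range is a priori only a `K`-subspace. Keeping the multiplier `f` arbitrary makes the
  -- induction over the `F`-span go through, since a new scalar is absorbed into it.
  have hsingle : ∀ k (n : N k) (f : F), (Pi.single k (f • n) : ∀ k, N k) ∈ LinearMap.range Ψ := by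
    intro k n
    have hn : n ∈ Submodule.span F (Set.range fun x : M₁ × M₂ => ψ k x.1 x.2) := by
      rw [hspan]
      trivial
    induction hn using Submodule.span_induction with
    | mem n hn =>
      obtain ⟨⟨m, n⟩, rfl⟩ := hn
      intro f
      convert hpure m n _ (hsep k f) using 1
      funext k'
      by_cases h : k' = k
      · subst h; simp
      · simp [h]
    | zero => intro f; simp
    | add x y _ _ hx hy =>
      intro f
      rw [smul_add, Pi.single_add]
      exact add_mem (hx f) (hy f)
    | smul g x _ hx =>
      intro f
      rw [smul_smul]
      exact hx _
  have hsurj : Function.Surjective Ψ := by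
    rw [← LinearMap.range_eq_top, eq_top_iff]
    rintro x -
    rw [← Finset.univ_sum_single x]
    refine sum_mem fun k _ => ?_
    have := hsingle k (x k) 1
    rwa [one_smul] at this
  have : FiniteDimensional K M₁ := Module.Finite.trans E₁ M₁
  have : FiniteDimensional K M₂ := Module.Finite.trans E₂ M₂
  have : ∀ k, FiniteDimensional K (N k) := fun k => Module.Finite.trans F (N k)
  have hdim : Module.finrank K (M₁ ⊗[K] M₂) = Module.finrank K (∀ k, N k) := by
    rw [Module.finrank_tensorProduct, Module.finrank_pi_fintype]
    simp only [← Module.finrank_mul_finrank K F (N _), hrank]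
    rw [← Module.finrank_mul_finrank K E₁ M₁, ← Module.finrank_mul_finrank K E₂ M₂,
      Finset.sum_const, Finset.card_univ, smul_eq_mul]
    linear_combination (Module.finrank E₁ M₁ * Module.finrank E₂ M₂) * hfield
  exact ⟨(LinearMap.injective_iff_surjective_of_finrank_eq_finrank hdim).2 hsurj, hsurj⟩

/-- `b` is a basis of the target of `σ` over its source. -/
def IsBasisAlong {K E : Type} [Field K] [Field E] (σ : K →+* E) {n : ℕ} (b : Fin n → E) : Prop :=
  ∀ f, ∃! g : Fin n → K, f = ∑ i, σ (g i) * b i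

theorem IsBasisAlong.finrank {K E : Type} [Field K] [Field E] {σ : K →+* E} {n : ℕ}
    {b : Fin n → E} (h : IsBasisAlong σ b) :
    letI := σ.toAlgebra
    FiniteDimensional K E ∧ Module.finrank K E = n := by
  let := σ.toAlgebra
  let e : (Fin n → K) →ₗ[K] E := Fintype.linearCombination K b
  have he : ∀ g, e g = ∑ i, σ (g i) * b i := fun g => by
    simp [e, Fintype.linearCombination_apply, Algebra.smul_def, RingHom.algebraMap_toAlgebra]
  have hbij : Function.Bijective e := by
    rw [Function.bijective_iff_existsUnique]
    intro f
    simpa only [he, eq_comm] using h f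
  let e' := LinearEquiv.ofBijective e hbij
  exact ⟨Module.Finite.equiv e', by rw [← e'.finrank_eq]; simp⟩

namespace ConnModule

variable {K E₁ E₂ F : Type} [Field K] [Differential K] [Field E₁] [Differential E₁]
  [Field E₂] [Differential E₂] [Field F] [Differential F]

/-- A criterion for a tensor product of push-forwards to be a sum of push-forwards. -/
theorem tensor_pushforward_isomorphic (ρ₁ : ChainHom K E₁) (ρ₂ : ChainHom K E₂)
    (π : ChainHom K F) {p₁ p₂ q : ℕ} {b₁ : Fin p₁ → E₁} {b₂ : Fin p₂ → E₂} {b : Fin q → F}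
    (hb₁ : IsBasisAlong ρ₁.hom b₁) (hb₂ : IsBasisAlong ρ₂.hom b₂) (hb : IsBasisAlong π.hom b)
    {ι : Type} [Fintype ι] [DecidableEq ι] (hcard : p₁ * p₂ = Fintype.card ι * q)
    (M₁ : ConnModule.{u} E₁) (M₂ : ConnModule.{v} E₂) (N : ι → ConnModule.{max u v} F)
    [FiniteDimensional E₁ M₁.carrier] [FiniteDimensional E₂ M₂.carrier]
    [∀ k, FiniteDimensional F (N k).carrier]
    (hrank : ∀ k, Module.finrank F (N k).carrier =
      Module.finrank E₁ M₁.carrier * Module.finrank E₂ M₂.carrier)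
    (τ₁ : ι → E₁ →+* F) (τ₂ : ι → E₂ →+* F)
    (hτ₁ : ∀ k f, τ₁ k (ρ₁.hom f) = π.hom f) (hτ₂ : ∀ k f, τ₂ k (ρ₂.hom f) = π.hom f)
    (hsep : ∀ k f, (Pi.single k f : ι → F) ∈ AddSubgroup.closure
      (Set.range fun (x : E₁ × E₂) k' => τ₁ k' x.1 * τ₂ k' x.2))
    (ψ : ∀ k, M₁.carrier →+ M₂.carrier →+ (N k).carrier)
    (hψ₁ : ∀ k a m n, ψ k (a • m) n = τ₁ k a • ψ k m n)
    (hψ₂ : ∀ k a m n, ψ k m (a • n) = τ₂ k a • ψ k m n)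
    (hspan : ∀ k, Submodule.span F
      (Set.range fun x : M₁.carrier × M₂.carrier => ψ k x.1 x.2) = ⊤)
    (hdel : ∀ k m n, (N k).del (ψ k m n) = π.jac •
      (ψ k (ρ₁.jac⁻¹ • M₁.del m) n + ψ k m (ρ₂.jac⁻¹ • M₂.del n))) :
    ((M₁.pushforward ρ₁).tensor (M₂.pushforward ρ₂)).Isomorphic
      (directSum fun k => (N k).pushforward π) := by
  let := ρ₁.hom.toAlgebra
  let := ρ₂.hom.toAlgebra
  let := π.hom.toAlgebra
  let m₁ : Module K M₁.carrier := Module.compHom M₁.carrier ρ₁.hom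
  let m₂ : Module K M₂.carrier := Module.compHom M₂.carrier ρ₂.hom
  let mN : ∀ k, Module K (N k).carrier := fun k => Module.compHom (N k).carrier π.hom
  have h₁ : ∀ (f : K) (m : M₁.carrier), f • m = ρ₁.hom f • m := fun _ _ => rfl
  have h₂ : ∀ (f : K) (m : M₂.carrier), f • m = ρ₂.hom f • m := fun _ _ => rfl
  have hN : ∀ k (f : K) (m : (N k).carrier), f • m = π.hom f • m := fun _ _ _ => rfl
  have : IsScalarTower K E₁ M₁.carrier := ⟨fun f a m => by
    rw [h₁, Algebra.smul_def, mul_smul]; rfl⟩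
  have : IsScalarTower K E₂ M₂.carrier := ⟨fun f a m => by
    rw [h₂, Algebra.smul_def, mul_smul]; rfl⟩
  have : ∀ k, IsScalarTower K F (N k).carrier := fun k => ⟨fun f a m => by
    rw [hN, Algebra.smul_def, mul_smul]; rfl⟩
  obtain ⟨_, hr₁⟩ := hb₁.finrank
  obtain ⟨_, hr₂⟩ := hb₂.finrank
  obtain ⟨_, hr⟩ := hb.finrank
  let Φ : ∀ k, M₁.carrier →ₗ[K] M₂.carrier →ₗ[K] (N k).carrier := fun k =>
    LinearMap.mk₂ K (fun m n => ψ k m n) (fun m m' n => by simp)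
      (fun f m n => by rw [h₁, hN, hψ₁, hτ₁]) (fun m n n' => by simp)
      (fun f m n => by rw [h₂, hN, hψ₂, hτ₂])
  have hΦ := tensor_lift_bijective Φ (fun k => τ₁ k) (fun k => τ₂ k) hψ₁ hψ₂ hspan hsep
    (by rw [hr₁, hr₂, hr, hcard]) hrank
  refine ⟨LinearEquiv.ofBijective _ hΦ, fun x => ?_⟩
  let δ : M₁.carrier ⊗[K] M₂.carrier →+ M₁.carrier ⊗[K] M₂.carrier :=
    tensorDel (M₁.pushforward ρ₁) (M₂.pushforward ρ₂)
  have hδ : ∀ m n, δ (m ⊗ₜ n) = (ρ₁.jac⁻¹ • M₁.del m) ⊗ₜ n + m ⊗ₜ (ρ₂.jac⁻¹ • M₂.del n) :=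
    fun _ _ => rfl
  change M₁.carrier ⊗[K] M₂.carrier at x
  change (LinearMap.pi fun k => TensorProduct.lift (Φ k)) (δ x) =
    fun k => π.jac⁻¹ • (N k).del ((LinearMap.pi fun k => TensorProduct.lift (Φ k)) x k)
  clear_value δ
  induction x using TensorProduct.induction_on with
  | zero =>
    funext k
    simp
  | tmul m n =>
    funext k
    rw [hδ, map_add]
    change ψ k (ρ₁.jac⁻¹ • M₁.del m) n + ψ k m (ρ₂.jac⁻¹ • M₂.del n) =
      π.jac⁻¹ • (N k).del (ψ k m n)
    rw [hdel, smul_smul, inv_mul_cancel₀ π.jac_ne, one_smul]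
  | add x y hx hy =>
    rw [map_add, map_add, hx, hy]
    funext k
    simp [smul_add]

end ConnModule

/-! ### The degree of u ↦ u^n and the separation of the branches -/

namespace DiscMap

theorem coeff_comp_power (n : ℕ) (hn : 0 < n) (f : Laurent) (k : ℤ) :
    ((power n hn).comp f).coeff k = if (n : ℤ) ∣ k then f.coeff (k / n) else 0 := by
  obtain ⟨N, g, rfl⟩ := exists_zpow_mul_coe f
  have hs : ∀ (a b : ℤ) (h : Laurent), (coord ^ a * h).coeff b = h.coeff (b - a) := by
    intro a b h
    rw [coord_zpow, HahnSeries.coeff_single_mul, one_mul]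
  have hn' : (0 : ℤ) < n := by exact_mod_cast hn
  rw [map_mul, map_zpow₀, comp_power_coord, comp_coe, ← zpow_natCast coord n, ← zpow_mul, hs, hs]
  change HahnSeries.coeff (((g.subst (PowerSeries.X ^ n : PowerSeries ℂ) : PowerSeries ℂ) :
    Laurent)) _ = _
  rw [PowerSeries.coeff_coe, PowerSeries.coeff_coe, PowerSeries.coeff_subst_X_pow hn.ne']
  have hdvd : n ∣ (k - n * N).natAbs ↔ (n : ℤ) ∣ k := by
    rw [← Int.natCast_dvd, dvd_sub_left (dvd_mul_right _ _)]
  by_cases hk : (n : ℤ) ∣ k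
  · obtain ⟨m, rfl⟩ := hk
    rw [if_pos (hdvd.2 (dvd_mul_right _ _)), if_pos (dvd_mul_right _ _),
      Int.mul_ediv_cancel_left _ hn'.ne', ← mul_sub, Int.natAbs_mul, Int.natAbs_natCast,
      Nat.mul_div_cancel_left _ hn]
    have : (n : ℤ) * (m - N) < 0 ↔ m - N < 0 :=
      ⟨fun h => by nlinarith, fun h => mul_neg_of_pos_of_neg hn' h⟩
    simp [this]
  · rw [if_neg (fun h => hk (hdvd.1 h)), if_neg hk, ite_self]

/-- Sorting exponents by their residue modulo n splits a series uniquely into n series in u^n, each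
multiplied by one of 1, u, …, u^(n-1). -/
theorem isBasisAlong_power (n : ℕ) (hn : 0 < n) :
    IsBasisAlong (power n hn).toChainHom.hom (fun i : Fin n => coord ^ ((i : ℕ) : ℤ)) := by
  have hn' : (0 : ℤ) < n := by exact_mod_cast hn
  have key : ∀ (g : Fin n → Laurent) (j : Fin n) (m : ℤ),
      (∑ i, (power n hn).comp (g i) * coord ^ ((i : ℕ) : ℤ)).coeff (n * m + (j : ℕ)) =
        (g j).coeff m := by
    intro g j m
    rw [HahnSeries.coeff_sum, Finset.sum_eq_single j]
    · rw [mul_comm, coord_zpow, HahnSeries.coeff_single_mul, one_mul, coeff_comp_power,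
        add_sub_cancel_right, if_pos (dvd_mul_right _ _), Int.mul_ediv_cancel_left _ hn'.ne']
    · intro i _ hij
      rw [mul_comm, coord_zpow, HahnSeries.coeff_single_mul, one_mul, coeff_comp_power, if_neg]
      rintro ⟨z, hz⟩
      apply hij
      have h1 := i.2
      have h2 := j.2
      have h3 : ((j : ℕ) : ℤ) - (i : ℕ) = n * (z - m) := by linarith
      have h4 := Int.eq_zero_of_abs_lt_dvd ⟨_, h3⟩ (abs_lt.2 ⟨by omega, by omega⟩)
      exact Fin.ext (by omega)
    · simp
  intro f
  have hb : ∀ j : Fin n, BddBelow (Function.support fun m : ℤ => f.coeff (n * m + (j : ℕ))) := by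
    intro j
    -- For m < 0 one has nm + j < n(m + 1) ≤ m + 1, so m below both bounds would force an exponent
    -- below the order of f; the 0 covers positive order.
    refine ⟨min f.order 0, fun m hm => ?_⟩
    have h1 : f.order ≤ n * m + (j : ℕ) := HahnSeries.order_le_of_coeff_ne_zero hm
    have h2 : ((j : ℕ) : ℤ) < n := by exact_mod_cast j.2
    by_contra! h3
    have h4 : m < 0 := lt_of_lt_of_le h3 (min_le_right _ _)
    have h5 : m < f.order := lt_of_lt_of_le h3 (min_le_left _ _)
    nlinarith
  have hsurj : f = ∑ i : Fin n, (power n hn).comp (HahnSeries.ofSuppBddBelow _ (hb i)) *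
      coord ^ ((i : ℕ) : ℤ) := by
    ext k
    have h1 := Int.emod_nonneg k hn'.ne'
    have h2 := Int.emod_lt_of_pos k hn'
    have h3 := key (fun i => HahnSeries.ofSuppBddBelow _ (hb i))
      ⟨(k % n).toNat, by omega⟩ (k / n)
    simp only [HahnSeries.coeff_ofSuppBddBelow, Int.toNat_of_nonneg h1,
      Int.mul_ediv_add_emod] at h3
    exact h3.symm
  refine ⟨_, hsurj, fun g hg => ?_⟩
  funext j
  ext m
  rw [← key g j m]
  change _ = f.coeff _
  rw [hg]
  rfl

/-- The components of `ℂ((u)) ⊗ ℂ((v))` over `ℂ((t))` are separated by the embeddings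
`(u, v) ↦ (w ^ n, (ζ_k w) ^ m)`. -/
theorem single_mem_closure {m n d p q : ℕ} (hm : 0 < m) (hn : 0 < n) (hp : 0 < p) (hq : 0 < q)
    (hd : 0 < d) (hmn : Nat.Coprime m n) (hpq : n * p = q) (ζ : Fin d → ℂ) (hζ : ∀ k, ζ k ≠ 0)
    (ω : ℂ) (hω : IsPrimitiveRoot (ω ^ n) d) (hζω : ∀ k, ζ k ^ m = ω ^ (k : ℕ))
    (k₀ : Fin d) (f : Laurent) :
    (Pi.single k₀ f : Fin d → Laurent) ∈ AddSubgroup.closure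
      (Set.range fun (x : Laurent × Laurent) k =>
        (power n hn).comp x.1 * (scale (ζ k) (hζ k)).comp ((power m hm).comp x.2)) := by
  have hω0 : ω ≠ 0 := by
    rintro rfl
    rw [zero_pow hn.ne'] at hω
    exact hω.ne_zero hd.ne' rfl
  -- With xn + ym = 1, the monomial w^c is, up to a constant, the image of u^(xc) v^(yc) on every
  -- branch.
  obtain ⟨x, y, hxy⟩ : IsCoprime (n : ℤ) (m : ℤ) := Nat.isCoprime_iff_coprime.2 hmn.symm
  obtain ⟨g, hg, -⟩ := isBasisAlong_power q hq f
  -- Orthogonality of the d-th roots of unity: averaging over j picks out the branch `k₀`.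
  have hsum : ∀ k : Fin d, (d : ℂ)⁻¹ * ∑ j : Fin d,
      ((ω ^ n) ^ ((k₀ : ℤ) - (k : ℤ))) ^ (j : ℕ) = if k = k₀ then 1 else 0 := by
    intro k
    have hd' : (d : ℂ) ≠ 0 := by exact_mod_cast hd.ne'
    rw [Fin.sum_univ_eq_sum_range (fun j => ((ω ^ n) ^ ((k₀ : ℤ) - (k : ℤ))) ^ j)]
    split_ifs with h
    · subst h
      simp [hd']
    · have h1 : (ω ^ n) ^ ((k₀ : ℤ) - (k : ℤ)) ≠ 1 := by
        rw [Ne, hω.zpow_eq_one_iff_dvd]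
        intro hdvd
        have h2 := k.2
        have h3 := k₀.2
        have := Int.eq_zero_of_abs_lt_dvd hdvd (abs_lt.2 ⟨by omega, by omega⟩)
        exact h (Fin.ext (by omega))
      rw [geom_sum_eq h1, ← zpow_natCast, ← zpow_mul, mul_comm _ (d : ℤ), zpow_mul, zpow_natCast,
        hω.pow_eq_one, one_zpow, sub_self, zero_div, mul_zero]
  -- The monomial u^(mj) v^(-nj) becomes the constant ω^(-nkj) on branch k, which tells the branches
  -- apart. The factor u^(xc) v^(yc) produces w^c, the coefficient g_c(w^q) comes from g_c(u^p), and
  -- the power of ω normalises the product on branch `k₀`; off `k₀` the sum over j vanishes.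
  let a : Fin q → Fin d → Laurent := fun c j => (power p hp).comp (g c) *
    HahnSeries.C ((d : ℂ)⁻¹ * ω ^ ((n : ℤ) * j * k₀ - k₀ * (y * c))) *
      coord ^ ((m : ℤ) * j + x * c)
  let b : Fin q → Fin d → Laurent := fun c j => coord ^ (-(n : ℤ) * j + y * c)
  have hpow : ∀ (l : ℕ) (hl : 0 < l) (e : ℤ), (power l hl).comp (coord ^ e) = coord ^ (l * e) := by
    intro l hl e
    rw [map_zpow₀, comp_power_coord, ← zpow_natCast, ← zpow_mul]
  have ha : ∀ c j, (power n hn).comp (a c j) = (power q hq).comp (g c) *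
      HahnSeries.C ((d : ℂ)⁻¹ * ω ^ ((n : ℤ) * j * k₀ - k₀ * (y * c))) *
        coord ^ ((n : ℤ) * (m * j + x * c)) := by
    intro c j
    rw [map_mul, map_mul, comp_power_power n p q hn hp hq hpq, comp_C, hpow]
  have hb : ∀ c j k, (scale (ζ k) (hζ k)).comp ((power m hm).comp (b c j)) =
      HahnSeries.C (ω ^ ((k : ℤ) * (-n * j + y * c))) *
        coord ^ ((m : ℤ) * (-n * j + y * c)) := by
    intro c j k
    rw [hpow, map_zpow₀, comp_scale_coord, mul_zpow, ← map_zpow₀]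
    congr 2
    rw [zpow_mul, zpow_natCast, hζω, ← zpow_natCast, ← zpow_mul]
  have hprod : ∀ c j k, (power n hn).comp (a c j) *
      (scale (ζ k) (hζ k)).comp ((power m hm).comp (b c j)) =
      (power q hq).comp (g c) * coord ^ ((c : ℕ) : ℤ) *
        (HahnSeries.C (ω ^ (((k : ℤ) - k₀) * (y * c))) *
          HahnSeries.C ((d : ℂ)⁻¹ * ((ω ^ n) ^ ((k₀ : ℤ) - (k : ℤ))) ^ (j : ℕ))) := by
    intro c j k
    have hX : coord ^ ((n : ℤ) * (m * j + x * c)) * coord ^ ((m : ℤ) * (-n * j + y * c)) =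
        coord ^ ((c : ℕ) : ℤ) := by
      rw [← zpow_add₀ coord_ne_zero]
      congr 1
      linear_combination (c : ℤ) * hxy
    have hC : (d : ℂ)⁻¹ * ω ^ ((n : ℤ) * j * k₀ - k₀ * (y * c)) *
        ω ^ ((k : ℤ) * (-n * j + y * c)) = ω ^ (((k : ℤ) - k₀) * (y * c)) *
          ((d : ℂ)⁻¹ * ((ω ^ n) ^ ((k₀ : ℤ) - (k : ℤ))) ^ (j : ℕ)) := by
      rw [mul_assoc, ← zpow_add₀ hω0, ← zpow_natCast, ← zpow_natCast ω n, ← zpow_mul, ← zpow_mul,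
        mul_left_comm (ω ^ _) (d : ℂ)⁻¹, ← zpow_add₀ hω0]
      congr 2
      ring
    rw [ha, hb, ← map_mul, ← hC, ← hX]
    simp only [map_mul]
    ring
  have hfin : (Pi.single k₀ f : Fin d → Laurent) = ∑ c, ∑ j, fun k =>
      (power n hn).comp (a c j) * (scale (ζ k) (hζ k)).comp ((power m hm).comp (b c j)) := by
    funext k
    simp only [Finset.sum_apply, hprod, ← Finset.mul_sum, ← map_sum, hsum]
    by_cases h : k = k₀
    · subst h
      simp only [Pi.single_eq_same, if_true, sub_self, zero_mul, zpow_zero, map_one, mul_one]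
      exact hg
    · simp [h]
  rw [hfin]
  exact sum_mem fun c _ => sum_mem fun j _ => AddSubgroup.subset_closure ⟨(a c j, b c j), rfl⟩

end DiscMap

/-! ### Pull-backs, tensor products and regularity -/

namespace ConnModule

variable {F E : Type} [Field F] [Differential F] [Field E] [Differential E]

theorem finrank_pullback (σ : ChainHom F E) (R : ConnModule.{u} F) :
    Module.finrank E (R.pullback σ).carrier = Module.finrank F R.carrier := by
  let := σ.hom.toAlgebra
  exact Module.finrank_baseChange (R := E) (S := F) (M' := R.carrier)

theorem finiteDimensional_tensor (R : ConnModule.{u} F) (S : ConnModule.{v} F)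
    [FiniteDimensional F R.carrier] [FiniteDimensional F S.carrier] :
    FiniteDimensional F (R.tensor S).carrier :=
  inferInstanceAs (FiniteDimensional F (R.carrier ⊗[F] S.carrier))

theorem finrank_tensor (R : ConnModule.{u} F) (S : ConnModule.{v} F) :
    Module.finrank F (R.tensor S).carrier =
      Module.finrank F R.carrier * Module.finrank F S.carrier :=
  Module.finrank_tensorProduct (R := F) (S := F) (M := R.carrier) (M' := S.carrier)

theorem finiteDimensional_expo_tensor (φ : F) (R : ConnModule.{u} F)
    [FiniteDimensional F R.carrier] : FiniteDimensional F ((expo φ).tensor R).carrier :=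
  inferInstanceAs (FiniteDimensional F (F ⊗[F] R.carrier))

theorem finrank_expo_tensor (φ : F) (R : ConnModule.{u} F) :
    Module.finrank F ((expo φ).tensor R).carrier = Module.finrank F R.carrier := by
  rw [finrank_tensor]
  exact (congrArg (· * _) (Module.finrank_self F)).trans (one_mul _)

/-- The basis is 1 ⊗ b_j, and ∂(1 ⊗ r) = jac ⊗ ∂r. The factor `σ.hom t` is kept undivided, so that
the case of u ↦ u^n can cancel it against the Jacobian. -/
theorem exists_basis_pullback (σ : ChainHom F E) {R : ConnModule.{u} F} {ι : Type} [Fintype ι]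
    (b : Module.Basis ι F R.carrier) (t : F) (B : ι → ι → F)
    (hB : ∀ j, t • R.del (b j) = ∑ i, B i j • b i) :
    ∃ b' : Module.Basis ι E (R.pullback σ).carrier, ∀ j,
      σ.hom t • (R.pullback σ).del (b' j) = σ.jac • ∑ i, σ.hom (B i j) • b' i := by
  let := σ.hom.toAlgebra
  let b' : Module.Basis ι E (E ⊗[F] R.carrier) := b.baseChange E
  have hb' : ∀ j, b' j = 1 ⊗ₜ b j := fun j => Module.Basis.baseChange_apply _ _ _
  have hσ : ∀ (f : F) (r : R.carrier), σ.hom f • ((1 : E) ⊗ₜ[F] r) = 1 ⊗ₜ (f • r) := by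
    intro f r
    rw [TensorProduct.tmul_smul]
    exact algebraMap_smul E f _
  refine ⟨b', fun j => ?_⟩
  change σ.hom t • pullbackDel σ.jac σ.chain R (b' j) = σ.jac • ∑ i, σ.hom (B i j) • b' i
  have hdel : pullbackDel σ.jac σ.chain R (b' j) = σ.jac • ((1 : E) ⊗ₜ R.del (b j)) := by
    rw [hb', pullbackDel_tmul, Derivation.map_one_eq_zero, TensorProduct.zero_tmul, zero_add,
      one_mul, TensorProduct.smul_tmul', smul_eq_mul, mul_one]
  rw [hdel, smul_comm, hσ, hB, TensorProduct.tmul_sum]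
  simp only [hb', hσ]

/-- The map `m ↦ 1 ⊗ m` from a module twisted by `𝓔^φ` to the untwisted pull-back. -/
theorem exists_semilinear_pullback (σ : ChainHom F E) (φ : F) (R : ConnModule.{u} F) :
    ∃ s : ((expo φ).tensor R).carrier →+ (R.pullback σ).carrier,
      (∀ a m, s (a • m) = σ.hom a • s m) ∧
      (∀ m, (R.pullback σ).del (s m) + (σ.hom φ)′ • s m =
        σ.jac • s (((expo φ).tensor R).del m)) ∧
      Submodule.span E (Set.range s) = ⊤ := by
  let := σ.hom.toAlgebra
  have hσ : ∀ (f : F) (r : R.carrier), σ.hom f • ((1 : E) ⊗ₜ[F] r) = 1 ⊗ₜ (f • r) := by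
    intro f r
    rw [TensorProduct.tmul_smul]
    exact algebraMap_smul E f _
  let s : F ⊗[F] R.carrier →+ E ⊗[F] R.carrier :=
    AddMonoidHom.mk' (fun m => (1 : E) ⊗ₜ[F] TensorProduct.lid F R.carrier m)
      (fun m n => by rw [map_add, TensorProduct.tmul_add])
  have hs : ∀ m, s m = (1 : E) ⊗ₜ[F] TensorProduct.lid F R.carrier m := fun _ => rfl
  let δ : F ⊗[F] R.carrier →+ F ⊗[F] R.carrier := tensorDel (expo φ) R
  have hδ : ∀ (a : F) (r : R.carrier), δ (a ⊗ₜ r) = (a′ + φ′ * a) ⊗ₜ r + a ⊗ₜ R.del r :=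
    fun _ _ => rfl
  refine ⟨s, fun a m => ?_, fun m => ?_, ?_⟩
  · have h : ∀ m : F ⊗[F] R.carrier, s (a • m) = σ.hom a • s m := fun m => by
      rw [hs, hs, map_smul, hσ]
    exact h m
  · change F ⊗[F] R.carrier at m
    change pullbackDel σ.jac σ.chain R (s m) + (σ.hom φ)′ • s m = σ.jac • s (δ m)
    clear_value δ
    induction m using TensorProduct.induction_on with
    | zero => simp
    | tmul a r =>
      -- The extra term from `expo φ` matches the twist (σφ)' = jac · σ(φ').
      have h1 : (1 : E) ⊗ₜ[F] ((φ′ * a) • r) = σ.hom (φ′) • ((1 : E) ⊗ₜ[F] (a • r)) := by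
        rw [hσ, mul_smul]
      rw [hs, hδ, map_add, hs, hs, TensorProduct.lid_tmul, TensorProduct.lid_tmul,
        TensorProduct.lid_tmul, pullbackDel_tmul, Derivation.map_one_eq_zero,
        TensorProduct.zero_tmul, zero_add, one_mul, add_smul, TensorProduct.tmul_add, h1, σ.chain,
        mul_smul, R.leibniz, TensorProduct.tmul_add]
      have h2 : ∀ r : R.carrier, σ.jac ⊗ₜ[F] r = σ.jac • ((1 : E) ⊗ₜ[F] r) := fun r => by
        rw [TensorProduct.smul_tmul', smul_eq_mul, mul_one]
      rw [h2, h2, smul_add, smul_add]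
      abel
    | add x y hx hy =>
      rw [map_add, map_add, map_add, map_add, smul_add, smul_add, ← hx, ← hy]
      abel
  · rw [eq_top_iff]
    rintro x -
    change E ⊗[F] R.carrier at x
    change x ∈ Submodule.span E (Set.range s)
    induction x using TensorProduct.induction_on with
    | zero => exact zero_mem _
    | tmul e r =>
      have h : e ⊗ₜ[F] r = e • s (1 ⊗ₜ r) := by
        rw [hs, TensorProduct.lid_tmul, one_smul, TensorProduct.smul_tmul', smul_eq_mul, mul_one]
      rw [h]
      exact Submodule.smul_mem _ _ (Submodule.subset_span ⟨_, rfl⟩)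
    | add x y hx hy => exact add_mem hx hy

theorem isRegular_of_basis {R : ConnModule.{u} Laurent} {ι : Type} [Fintype ι]
    (b : Module.Basis ι Laurent R.carrier) (A : ι → ι → PowerSeries ℂ)
    (hA : ∀ j, coord • R.del (b j) = ∑ i, ((A i j : PowerSeries ℂ) : Laurent) • b i) :
    R.IsRegular := by
  let e := Fintype.equivFin ι
  refine ⟨Fintype.card ι, b.reindex e, Matrix.of fun i j => A (e.symm i) (e.symm j), fun j => ?_⟩
  rw [← coord_eq, Module.Basis.reindex_apply, hA, ← e.symm.sum_comp]
  simp

theorem IsRegular.finiteDimensional {R : ConnModule.{u} Laurent} (hR : R.IsRegular) :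
    FiniteDimensional Laurent R.carrier := by
  obtain ⟨n, b, -⟩ := hR
  exact Module.Finite.of_basis b

/-- Cancelling u^(n-1) between u^n and the Jacobian n u^(n-1) leaves the matrix n A(u^n) for u∂_u,
which is again integral. -/
theorem IsRegular.pull_power {R : ConnModule.{u} Laurent} (hR : R.IsRegular) (n : ℕ)
    (hn : 0 < n) : (pull (DiscMap.power n hn) R).IsRegular := by
  obtain ⟨m, b, A, hA⟩ := hR
  rw [← coord_eq] at hA
  obtain ⟨b', hb'⟩ := exists_basis_pullback (DiscMap.power n hn).toChainHom b coord
    (fun i j => ((A i j : PowerSeries ℂ) : Laurent)) hA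
  refine isRegular_of_basis b' (fun i j => PowerSeries.C (n : ℂ) *
    (A i j).subst (DiscMap.power n hn).series) fun j => ?_
  have h := hb' j
  change (DiscMap.power n hn).comp coord • _ = _ • ∑ i, (DiscMap.power n hn).comp _ • _ at h
  rw [DiscMap.jac_power, DiscMap.comp_power_coord] at h
  rw [← pow_sub_one_mul hn.ne' coord, mul_smul, mul_comm (n : Laurent), mul_smul] at h
  refine (smul_right_injective _ (pow_ne_zero (n - 1) coord_ne_zero) h).trans ?_
  rw [Finset.smul_sum]
  refine Finset.sum_congr rfl fun i _ => ?_
  rw [smul_smul, DiscMap.comp_coe, PowerSeries.coe_mul]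
  congr 2
  rw [map_natCast (PowerSeries.C (R := ℂ)), map_natCast]

/-- In the product basis the matrix of u∂_u is A ⊗ 1 + 1 ⊗ B. -/
theorem IsRegular.tensor {R : ConnModule.{u} Laurent} {S : ConnModule.{v} Laurent}
    (hR : R.IsRegular) (hS : S.IsRegular) : (R.tensor S).IsRegular := by
  obtain ⟨m, b, A, hA⟩ := hR
  obtain ⟨n, c, B, hB⟩ := hS
  rw [← coord_eq] at hA hB
  let bc : Module.Basis (Fin m × Fin n) Laurent (R.carrier ⊗[Laurent] S.carrier) :=
    b.tensorProduct c
  have hbc : ∀ i j, bc (i, j) = b i ⊗ₜ c j := fun i j => Module.Basis.tensorProduct_apply _ _ _ _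
  refine isRegular_of_basis (R := R.tensor S) bc
    (fun x y => (if x.2 = y.2 then A x.1 y.1 else 0) + if x.1 = y.1 then B x.2 y.2 else 0) ?_
  rintro ⟨i, j⟩
  change coord • tensorDel R S (bc (i, j)) = ∑ x, _ • bc x
  rw [hbc, tensorDel_tmul, smul_add, TensorProduct.smul_tmul', ← TensorProduct.tmul_smul, hA, hB,
    TensorProduct.sum_tmul, TensorProduct.tmul_sum]
  simp only [PowerSeries.coe_add, add_smul, Finset.sum_add_distrib]
  congr 1
  · rw [Fintype.sum_prod_type]
    refine Finset.sum_congr rfl fun i' _ => ?_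
    rw [Finset.sum_eq_single j]
    · simp [hbc, TensorProduct.smul_tmul']
    · intro j' _ hj
      simp [hj]
    · simp
  · rw [Fintype.sum_prod_type_right]
    refine Finset.sum_congr rfl fun j' _ => ?_
    rw [Finset.sum_eq_single i]
    · simp [hbc]
    · intro i' _ hi
      simp [hi]
    · simp

end ConnModule

/-! ### Twisted semilinear maps and their pairings -/

namespace ConnModule

variable {K E E₁ E₂ F : Type} [Field K] [Differential K] [Field E] [Differential E]
  [Field E₁] [Differential E₁] [Field E₂] [Differential E₂] [Field F] [Differential F]

/-- A semilinear map that is horizontal up to a twist by the form `θ`, with spanning image. -/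
structure IsTwisted (σ : ChainHom E F) (θ : F) {M : ConnModule.{u} E} {P : ConnModule.{v} F}
    (s : M.carrier →+ P.carrier) : Prop where
  map_smul : ∀ a m, s (a • m) = σ.hom a • s m
  del_map : ∀ m, P.del (s m) + θ • s m = σ.jac • s (M.del m)
  span_range : Submodule.span F (Set.range s) = ⊤

/-- The pairing is 1 ⊗ (s₁ m ⊗ s₂ n). The twists of the two factors add up to φ', which is what the
generator of `expo φ` contributes, and the Jacobian hypotheses are the chain rule for π = σᵢ ∘ ρᵢ on
fields. -/
theorem exists_twisted_pairing {σ₁ : ChainHom E₁ F} {σ₂ : ChainHom E₂ F} {ρ₁ : ChainHom K E₁}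
    {ρ₂ : ChainHom K E₂} {π : ChainHom K F} (hj₁ : π.jac = σ₁.jac * σ₁.hom ρ₁.jac)
    (hj₂ : π.jac = σ₂.jac * σ₂.hom ρ₂.jac) {φ θ₁ θ₂ : F} (hφ : φ′ = θ₁ + θ₂)
    {M₁ : ConnModule.{u} E₁} {M₂ : ConnModule.{v} E₂} {P : ConnModule.{u} F}
    {Q : ConnModule.{v} F} {s₁ : M₁.carrier →+ P.carrier} {s₂ : M₂.carrier →+ Q.carrier}
    (hs₁ : IsTwisted σ₁ θ₁ s₁) (hs₂ : IsTwisted σ₂ θ₂ s₂) :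
    ∃ ψ : M₁.carrier →+ M₂.carrier →+ ((expo φ).tensor (P.tensor Q)).carrier,
      (∀ a m n, ψ (a • m) n = σ₁.hom a • ψ m n) ∧
      (∀ a m n, ψ m (a • n) = σ₂.hom a • ψ m n) ∧
      Submodule.span F (Set.range fun x : M₁.carrier × M₂.carrier => ψ x.1 x.2) = ⊤ ∧
      ∀ m n, ((expo φ).tensor (P.tensor Q)).del (ψ m n) = π.jac •
        (ψ (ρ₁.jac⁻¹ • M₁.del m) n + ψ m (ρ₂.jac⁻¹ • M₂.del n)) := by
  let ψ : M₁.carrier →+ M₂.carrier →+ F ⊗[F] (P.carrier ⊗[F] Q.carrier) :=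
    AddMonoidHom.mk' (fun m => AddMonoidHom.mk' (fun n => (1 : F) ⊗ₜ[F] (s₁ m ⊗ₜ[F] s₂ n))
        (fun n n' => by rw [map_add, TensorProduct.tmul_add, TensorProduct.tmul_add]))
      (fun m m' => by
        ext n
        simp only [map_add, TensorProduct.add_tmul, TensorProduct.tmul_add, AddMonoidHom.mk'_apply,
          AddMonoidHom.add_apply])
  have hψ : ∀ m n, ψ m n = (1 : F) ⊗ₜ[F] (s₁ m ⊗ₜ[F] s₂ n) := fun _ _ => rfl
  have hψ₁ : ∀ a m n, ψ (a • m) n = σ₁.hom a • ψ m n := fun a m n => by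
    rw [hψ, hψ, hs₁.map_smul, ← TensorProduct.smul_tmul', TensorProduct.tmul_smul]
  have hψ₂ : ∀ a m n, ψ m (a • n) = σ₂.hom a • ψ m n := fun a m n => by
    rw [hψ, hψ, hs₂.map_smul, TensorProduct.tmul_smul, TensorProduct.tmul_smul]
  have hspan : Submodule.span F (Set.range fun x : M₁.carrier × M₂.carrier => ψ x.1 x.2) = ⊤ := by
    set W := Submodule.span F (Set.range fun x : M₁.carrier × M₂.carrier => ψ x.1 x.2) with hW
    have h1 : ∀ m y, (1 : F) ⊗ₜ[F] (s₁ m ⊗ₜ[F] y) ∈ W := by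
      intro m y
      have hy : y ∈ Submodule.span F (Set.range s₂) := by
        rw [hs₂.span_range]
        trivial
      induction hy using Submodule.span_induction with
      | mem y hy =>
        obtain ⟨n, rfl⟩ := hy
        exact Submodule.subset_span ⟨(m, n), rfl⟩
      | zero => simp
      | add y z _ _ hy hz =>
        rw [TensorProduct.tmul_add, TensorProduct.tmul_add]
        exact add_mem hy hz
      | smul a y _ hy =>
        rw [TensorProduct.tmul_smul, TensorProduct.tmul_smul]
        exact W.smul_mem _ hy
    have h2 : ∀ x y, (1 : F) ⊗ₜ[F] (x ⊗ₜ[F] y) ∈ W := by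
      intro x y
      have hx : x ∈ Submodule.span F (Set.range s₁) := by
        rw [hs₁.span_range]
        trivial
      induction hx using Submodule.span_induction with
      | mem x hx =>
        obtain ⟨m, rfl⟩ := hx
        exact h1 m y
      | zero => simp
      | add x z _ _ hx hz =>
        rw [TensorProduct.add_tmul, TensorProduct.tmul_add]
        exact add_mem hx hz
      | smul a x _ hx =>
        rw [← TensorProduct.smul_tmul', TensorProduct.tmul_smul]
        exact W.smul_mem _ hx
    rw [eq_top_iff]
    rintro z -
    induction z using TensorProduct.induction_on with
    | zero => exact zero_mem _
    | tmul f z =>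
      induction z using TensorProduct.induction_on with
      | zero => simp
      | tmul x y =>
        have h : f ⊗ₜ[F] (x ⊗ₜ[F] y) = f • ((1 : F) ⊗ₜ[F] (x ⊗ₜ[F] y)) := by
          rw [TensorProduct.smul_tmul', smul_eq_mul, mul_one]
        rw [h]
        exact W.smul_mem _ (h2 x y)
      | add x y hx hy =>
        rw [TensorProduct.tmul_add]
        exact add_mem hx hy
    | add x y hx hy => exact add_mem hx hy
  refine ⟨ψ, hψ₁, hψ₂, hspan, fun m n => ?_⟩
  change (1′ + φ′ * 1) ⊗ₜ[F] (s₁ m ⊗ₜ[F] s₂ n) +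
    (1 : F) ⊗ₜ[F] (P.del (s₁ m) ⊗ₜ[F] s₂ n + s₁ m ⊗ₜ[F] Q.del (s₂ n)) =
      π.jac • (ψ (ρ₁.jac⁻¹ • M₁.del m) n + ψ m (ρ₂.jac⁻¹ • M₂.del n))
  have hc : ∀ {E : Type} [Field E] (τ : E →+* F) (a : E) (b : F), a ≠ 0 →
      b * τ a * τ a⁻¹ = b := fun τ a b ha => by
    rw [mul_assoc, ← map_mul, mul_inv_cancel₀ ha, map_one, mul_one]
  have h₁ : π.jac • ψ (ρ₁.jac⁻¹ • M₁.del m) n =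
      (1 : F) ⊗ₜ[F] ((P.del (s₁ m) + θ₁ • s₁ m) ⊗ₜ[F] s₂ n) := by
    rw [hψ₁, smul_smul, hj₁, hc _ _ _ ρ₁.jac_ne, hψ, hs₁.del_map, ← TensorProduct.smul_tmul',
      TensorProduct.tmul_smul]
  have h₂ : π.jac • ψ m (ρ₂.jac⁻¹ • M₂.del n) =
      (1 : F) ⊗ₜ[F] (s₁ m ⊗ₜ[F] (Q.del (s₂ n) + θ₂ • s₂ n)) := by
    rw [hψ₂, smul_smul, hj₂, hc _ _ _ ρ₂.jac_ne, hψ, hs₂.del_map, TensorProduct.tmul_smul,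
      TensorProduct.tmul_smul]
  have h₀ : (1′ + φ′ * 1) ⊗ₜ[F] (s₁ m ⊗ₜ[F] s₂ n) =
      (θ₁ + θ₂) • ((1 : F) ⊗ₜ[F] (s₁ m ⊗ₜ[F] s₂ n)) := by
    rw [Derivation.map_one_eq_zero, zero_add, mul_one, hφ, TensorProduct.smul_tmul', smul_eq_mul,
      mul_one]
  rw [smul_add, h₁, h₂, h₀]
  simp only [TensorProduct.add_tmul, TensorProduct.tmul_add, ← TensorProduct.smul_tmul',
    TensorProduct.tmul_smul, add_smul]
  abel

end ConnModule

/-- Composition of homomorphisms with chain rule. -/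
noncomputable def ChainHom.trans {K E F : Type} [Field K] [Differential K] [Field E]
    [Differential E] [Field F] [Differential F] (ρ : ChainHom K E) (σ : ChainHom E F) :
    ChainHom K F where
  hom := σ.hom.comp ρ.hom
  jac := σ.jac * σ.hom ρ.jac
  jac_ne := mul_ne_zero σ.jac_ne (by simpa using ρ.jac_ne)
  chain f := by
    rw [RingHom.comp_apply, σ.chain, ρ.chain, map_mul, RingHom.comp_apply]
    ring

theorem deriv_coord : coord′ = 1 := by
  rw [coord, deriv_coe, PowerSeries.derivative_X, PowerSeries.coe_one]

theorem ChainHom.jac_eq {F : Type} [Field F] [Differential F] (σ : ChainHom Laurent F) :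
    σ.jac = (σ.hom coord)′ := by
  rw [σ.chain, deriv_coord, map_one, mul_one]

/-- The factor is the derivative of the image of the coordinate, so the Jacobian conditions of a
pairing reduce to equalities of homomorphisms. -/
theorem ChainHom.jac_congr {F : Type} [Field F] [Differential F] {σ τ : ChainHom Laurent F}
    (h : ∀ f, σ.hom f = τ.hom f) : σ.jac = τ.jac := by
  rw [σ.jac_eq, τ.jac_eq, h]

/-! ### Rotating the second factor and assembling the branches -/

namespace ConnModule

/-- The monodromy operators turn a twisted map into one along `u ↦ ρ(e^c u)`. -/
theorem IsTwisted.exists_rotate {ρ : ChainHom Laurent Laurent} {φ : Laurent}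
    {M : ConnModule.{u} Laurent} {P : ConnModule.{v} Laurent} {s : M.carrier →+ P.carrier}
    (hs : IsTwisted ρ (ρ.hom φ)′ s) (hP : P.IsRegular) (c : ℂ) (hc : Complex.exp c ≠ 0) :
    ∃ s' : M.carrier →+ P.carrier, IsTwisted (ρ.trans (DiscMap.scale _ hc).toChainHom)
      ((DiscMap.scale _ hc).comp (ρ.hom φ))′ s' := by
  obtain ⟨T, hT₁, hT₂, hT₃⟩ := hP.exists_monodromy c
  set σ := DiscMap.scale (Complex.exp c) hc with hσ
  have hj : σ.toChainHom.jac = HahnSeries.C (Complex.exp c) := DiscMap.jac_scale _ _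
  have hch : ∀ f, (σ.comp f)′ = HahnSeries.C (Complex.exp c) * σ.comp (f′) := fun f => by
    rw [← hj]
    exact σ.chain f
  -- Composing with `T` changes the semilinearity but not the target `P`; this is why the same
  -- regular part occurs on every branch.
  refine ⟨T.comp s, fun a m => ?_, fun m => ?_, ?_⟩
  · change T (s (a • m)) = σ.comp (ρ.hom a) • T (s m)
    rw [hs.map_smul, hT₁]
  · change P.del (T (s m)) + (σ.comp (ρ.hom φ))′ • T (s m) =
      (σ.toChainHom.jac * σ.comp ρ.jac) • T (s (M.del m))
    rw [hT₂, hch, hj, mul_smul, mul_smul, ← hT₁, ← hT₁, ← smul_add, ← map_add, hs.del_map]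
  · rw [eq_top_iff, ← hT₃, Submodule.span_le]
    rintro _ ⟨x, rfl⟩
    have hx : x ∈ Submodule.span Laurent (Set.range s) := by
      rw [hs.span_range]
      trivial
    induction hx using Submodule.span_induction with
    | mem x hx =>
      obtain ⟨m, rfl⟩ := hx
      exact Submodule.subset_span ⟨m, rfl⟩
    | zero =>
      rw [map_zero]
      exact zero_mem _
    | add x y _ _ hx hy =>
      rw [map_add]
      exact add_mem hx hy
    | smul a x _ hx =>
      rw [hT₁]
      exact Submodule.smul_mem _ _ hx

/-- The tensor product of two elementary formal connections of ramification orders `d m` and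
`d n`, with `m` and `n` coprime. -/
theorem tensor_El_isomorphic {m n d p₁ p₂ q : ℕ} (hm : 0 < m) (hn : 0 < n)
    (hd : 0 < d) (hp₁ : 0 < p₁) (hp₂ : 0 < p₂) (hq : 0 < q) (hmn : Nat.Coprime m n)
    (hp₁m : p₁ = d * m) (hp₂n : p₂ = d * n) (hqd : q = d * m * n)
    (c : Fin d → ℂ) (hc : ∀ k, Complex.exp (c k) ≠ 0) (ω : ℂ) (hω : IsPrimitiveRoot ω p₂)
    (hcω : ∀ k, Complex.exp (c k) ^ m = ω ^ (k : ℕ))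
    (φ₁ φ₂ : Laurent) {R₁ : ConnModule.{u} Laurent} {R₂ : ConnModule.{v} Laurent}
    (hR₁ : R₁.IsRegular) (hR₂ : R₂.IsRegular) :
    ((El (DiscMap.power p₁ hp₁) φ₁ R₁).tensor (El (DiscMap.power p₂ hp₂) φ₂ R₂)).Isomorphic
      (directSum fun k : Fin d => El (DiscMap.power q hq)
        ((DiscMap.power n hn).comp φ₁ +
          (DiscMap.scale _ (hc k)).comp ((DiscMap.power m hm).comp φ₂))
        ((pull (DiscMap.power n hn) R₁).tensor (pull (DiscMap.power m hm) R₂))) := by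
  have := hR₁.finiteDimensional
  have := hR₂.finiteDimensional
  have hS₁ := hR₁.pull_power n hn
  have hS₂ := hR₂.pull_power m hm
  have := hS₁.finiteDimensional
  have := hS₂.finiteDimensional
  have := finiteDimensional_tensor (pull (DiscMap.power n hn) R₁) (pull (DiscMap.power m hm) R₂)
  have := finiteDimensional_expo_tensor φ₁ R₁
  have := finiteDimensional_expo_tensor φ₂ R₂
  have := fun φ => finiteDimensional_expo_tensor φ
    ((pull (DiscMap.power n hn) R₁).tensor (pull (DiscMap.power m hm) R₂))
  obtain ⟨s₁, hs₁⟩ := exists_semilinear_pullback (DiscMap.power n hn).toChainHom φ₁ R₁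
  obtain ⟨s₂, hs₂⟩ := exists_semilinear_pullback (DiscMap.power m hm).toChainHom φ₂ R₂
  have ht₁ : IsTwisted (P := pull (DiscMap.power n hn) R₁) (DiscMap.power n hn).toChainHom
    ((DiscMap.power n hn).toChainHom.hom φ₁)′ s₁ := ⟨hs₁.1, hs₁.2.1, hs₁.2.2⟩
  have ht₂ : IsTwisted (P := pull (DiscMap.power m hm) R₂) (DiscMap.power m hm).toChainHom
    ((DiscMap.power m hm).toChainHom.hom φ₂)′ s₂ := ⟨hs₂.1, hs₂.2.1, hs₂.2.2⟩
  choose s hs using fun k => ht₂.exists_rotate hS₂ (c k) (hc k)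
  have hτ₁ : ∀ f, (DiscMap.power n hn).comp ((DiscMap.power p₁ hp₁).comp f) =
      (DiscMap.power q hq).comp f :=
    DiscMap.comp_power_power n p₁ q hn hp₁ hq (by rw [hp₁m, hqd]; ring)
  have hτ₂ : ∀ k f, (DiscMap.scale _ (hc k)).comp ((DiscMap.power m hm).comp
      ((DiscMap.power p₂ hp₂).comp f)) = (DiscMap.power q hq).comp f := by
    intro k f
    rw [DiscMap.comp_power_power m p₂ q hm hp₂ hq (by rw [hp₂n, hqd]; ring),
      DiscMap.comp_scale_power]
    -- Here q = p₂ m, so the q-th power of e^(c_k) is (ω^k)^(p₂) = 1.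
    rw [hqd, mul_right_comm, ← hp₂n, mul_comm, pow_mul, hcω, ← pow_mul, mul_comm, pow_mul,
      hω.pow_eq_one, one_pow]
  choose ψ hψ using fun k => exists_twisted_pairing
    (ρ₁ := (DiscMap.power p₁ hp₁).toChainHom) (ρ₂ := (DiscMap.power p₂ hp₂).toChainHom)
    (π := (DiscMap.power q hq).toChainHom)
    (ChainHom.jac_congr (τ := (DiscMap.power p₁ hp₁).toChainHom.trans
      (DiscMap.power n hn).toChainHom) fun f => (hτ₁ f).symm)
    (ChainHom.jac_congr (τ := (DiscMap.power p₂ hp₂).toChainHom.trans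
      ((DiscMap.power m hm).toChainHom.trans (DiscMap.scale _ (hc k)).toChainHom))
      fun f => (hτ₂ k f).symm)
    (deriv_add ((DiscMap.power n hn).comp φ₁)
      ((DiscMap.scale _ (hc k)).comp ((DiscMap.power m hm).comp φ₂))) ht₁ (hs k)
  refine tensor_pushforward_isomorphic (DiscMap.power p₁ hp₁).toChainHom
    (DiscMap.power p₂ hp₂).toChainHom (DiscMap.power q hq).toChainHom
    (DiscMap.isBasisAlong_power p₁ hp₁) (DiscMap.isBasisAlong_power p₂ hp₂)
    (DiscMap.isBasisAlong_power q hq) (by rw [Fintype.card_fin, hqd, hp₁m, hp₂n]; ring) _ _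
    (fun k => (expo ((DiscMap.power n hn).comp φ₁ + (DiscMap.scale _ (hc k)).comp
      ((DiscMap.power m hm).comp φ₂))).tensor
        ((pull (DiscMap.power n hn) R₁).tensor (pull (DiscMap.power m hm) R₂)))
    (fun k => ?_) (fun _ => (DiscMap.power n hn).comp)
    (fun k => (DiscMap.scale _ (hc k)).comp.comp (DiscMap.power m hm).comp)
    (fun _ => hτ₁) hτ₂ (fun k f => ?_) ψ (fun k => (hψ k).1) (fun k => (hψ k).2.1)
    (fun k => (hψ k).2.2.1) (fun k => (hψ k).2.2.2)
  · rw [finrank_expo_tensor, finrank_expo_tensor, finrank_expo_tensor, finrank_tensor, pull, pull,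
      finrank_pullback, finrank_pullback]
  -- Since p₂ = dn, the power ω^n is a primitive d-th root of unity.
  · exact DiscMap.single_mem_closure hm hn hp₁ hq hd hmn (by rw [hp₁m, hqd]; ring) _ hc ω
      (hω.pow hp₂ (by rw [hp₂n, mul_comm])) hcω k f

end ConnModule

end FormalConn

/-! ### Specialisation to the explicit roots of unity -/

theorem proposition3p4 (p₁ p₂ : ℕ) (hp₁ : 0 < p₁) (hp₂ : 0 < p₂)
    (φ₁ φ₂ : FormalConn.Laurent)
    (R₁ : FormalConn.ConnModule.{u} FormalConn.Laurent)
    (R₂ : FormalConn.ConnModule.{v} FormalConn.Laurent)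
    (hR₁ : R₁.IsRegular) (hR₂ : R₂.IsRegular)
    (d p₁' p₂' q : ℕ) (hd : d = Nat.gcd p₁ p₂)
    (hp₁' : p₁' = p₁ / d) (hp₂' : p₂' = p₂ / d) (hq : q = p₁ * p₂ / d)
    (h₁ : 0 < p₁') (h₂ : 0 < p₂') (h₃ : 0 < q)
    (R : FormalConn.ConnModule.{max u v} FormalConn.Laurent)
    (hR : R = (FormalConn.pull (FormalConn.DiscMap.power p₂' h₂) R₁).tensor
      (FormalConn.pull (FormalConn.DiscMap.power p₁' h₁) R₂))
    (φ : Fin d → FormalConn.Laurent)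
    (hφ : ∀ k : Fin d, φ k = (FormalConn.DiscMap.power p₂' h₂).comp φ₁ +
      (FormalConn.DiscMap.scale
          (Complex.exp (2 * Real.pi * Complex.I * (k : ℕ) * d / (p₁ * p₂)))
          (Complex.exp_ne_zero _)).comp
        ((FormalConn.DiscMap.power p₁' h₁).comp φ₂)) :
    R.IsRegular ∧
    ((FormalConn.El (FormalConn.DiscMap.power p₁ hp₁) φ₁ R₁).tensor
        (FormalConn.El (FormalConn.DiscMap.power p₂ hp₂) φ₂ R₂)).Isomorphic
      (FormalConn.ConnModule.directSum fun k : Fin d =>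
        FormalConn.El (FormalConn.DiscMap.power q h₃) (φ k) R) := by
  have hd0 : 0 < d := hd ▸ Nat.gcd_pos_of_pos_left _ hp₁
  have hp₁m : p₁ = d * p₁' := by
    rw [hp₁', Nat.mul_div_cancel' (hd ▸ Nat.gcd_dvd_left _ _)]
  have hp₂n : p₂ = d * p₂' := by
    rw [hp₂', Nat.mul_div_cancel' (hd ▸ Nat.gcd_dvd_right _ _)]
  have hmn : Nat.Coprime p₁' p₂' := by
    rw [hp₁', hp₂', hd]
    exact Nat.coprime_div_gcd_div_gcd (hd ▸ hd0)
  have hqd : q = d * p₁' * p₂' := by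
    rw [hq, hp₂n, mul_left_comm, Nat.mul_div_cancel_left _ hd0, ← hp₁m]
  obtain rfl : φ = _ := funext hφ
  subst hR
  refine ⟨(hR₁.pull_power p₂' h₂).tensor (hR₂.pull_power p₁' h₁), ?_⟩
  refine FormalConn.ConnModule.tensor_El_isomorphic h₁ h₂ hd0 hp₁ hp₂ h₃ hmn hp₁m hp₂n hqd _
    (fun k => Complex.exp_ne_zero _) _ (Complex.isPrimitiveRoot_exp p₂ hp₂.ne') (fun k => ?_)
    φ₁ φ₂ hR₁ hR₂
  -- With ω = e^(2πi/p₂) the claim is p₁' · 2πikd/(p₁p₂) = k · 2πi/p₂, which holds because p₁ = d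
  -- p₁'.
  rw [← Complex.exp_nat_mul, ← Complex.exp_nat_mul]
  congr 1
  have e₁ : (p₁ : ℂ) = d * p₁' := by exact_mod_cast hp₁m
  have e₂ : (d : ℂ) ≠ 0 := by exact_mod_cast hd0.ne'
  have e₃ : (p₁' : ℂ) ≠ 0 := by exact_mod_cast h₁.ne'
  have e₄ : (p₂ : ℂ) ≠ 0 := by exact_mod_cast hp₂.ne'
  rw [e₁]
  field_simp
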